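/- Let $V:\mathbb{R}\to\mathbb{R}$ be convex, with $|V(x)|\le C_0(1+|x|)^{K}$ for all $x\in\mathbb{R}$ for some $C_0>0$, $K\ge 1$, and non-affine in the sense that $\lim_{x\to-\infty}V(x)/x<\lim_{x\to+\infty}V(x)/x$ (limits in $[-\infty,\infty]$). For $N\ge 2$ let $\Omega_N=\{x=(x_0,\dots,x_N)\in\mathbb{R}^{N+1}: x_0=x_N=0\}$, and let $\pi_N$ be the probability measure on $\Omega_N$ with density $e^{-H(x)}/Z_N$ with respect to $dx_1\cdots dx_{N-1}$, where $H(x)=\sum_{k=1}^N V(x_k-x_{k-1})$ and $Z_N$ is the normalization constant. For $k=1,\dots,N-1$ set $$\mathcal{Q}_kf(x)=\int_{\mathbb{R}} f(x^{(k,u)})\,\rho_{x_{k-1},x_{k+1}}(u)\,du,\qquad \rho_{b,c}(u)=\frac{e^{-V(u-b)-V(c-u)}}{\int_{\mathbb{R}} e^{-V(s-b)-V(c-s)}\,ds},$$ where $x^{(k,u)}$ is $x$ with its $k$-th coordinate replaced by $u$. Let $P^x_t$ be the law at time $t\ge0$ of the continuous-time Markov chain on $\Omega_N$ with generator $\mathcal{L}f=\sum_{k=1}^{N-1}(\mathcal{Q}_kf-f)$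 started from $x$. Let $$d_N(t)=\sup_{x\in\Omega_N:\ \max_i|x_i|\le N}\|P^x_t-\pi_N\|_{TV},\qquad \|\mu-\nu\|_{TV}=\sup_{B\ \mathrm{Borel}}\big(\mu(B)-\nu(B)\big),$$ $T_N(\varepsilon)=\inf\{t\ge0: d_N(t)<\varepsilon\}$ (with $\inf\emptyset=+\infty$) and $\lambda_N=1-\cos(\pi/N)$. Then there is a constant $c>0$, depending only on $V$, such that for every integer $N\ge2$ and every $t\ge0$ $$d_N(t)\ \ge\ 1-\frac{1}{1+c\,N\,e^{-2\lambda_N t}}.$$ As a consequence, there is a constant $C\in\mathbb{R}$, depending only on $V$, such that for every integer $N\ge2$ and every $\varepsilon\in(0,1)$ $$T_N(\varepsilon)\ \ge\ \frac{1}{2\lambda_N}\big(\log N+\log(1-\varepsilon)-C\big).$$ -/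

import Mathlib

open MeasureTheory ProbabilityTheory Filter Topology Set

namespace GradPhi

/-- The class of admissible potentials: convex, of at most polynomial growth, and non-affine in the
sense that the asymptotic slopes at `-∞` and `+∞` (which may be infinite) are strictly ordered. -/
structure Admissible (V : ℝ → ℝ) : Prop where
  convex : ConvexOn ℝ univ V
  growth : ∃ C K : ℝ, 0 < C ∧ 1 ≤ K ∧ ∀ x, |V x| ≤ C * (1 + |x|) ^ K
  nonaffine : ∃ sMinus sPlus : EReal,
    Tendsto (fun x : ℝ => ((V x / x : ℝ) : EReal)) atBot (𝓝 sMinus) ∧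
    Tendsto (fun x : ℝ => ((V x / x : ℝ) : EReal)) atTop (𝓝 sPlus) ∧
    sMinus < sPlus

/-- The state space: heights `(x_0, …, x_N)` pinned to `0` at both ends. It carries the
(Borel) σ-algebra induced by `ℝ^(N+1)`. -/
abbrev Omega (N : ℕ) : Type :=
  {x : Fin (N + 1) → ℝ // x 0 = 0 ∧ x (Fin.last N) = 0}

variable {N : ℕ}

/-- The interior site `k + 1 ∈ {1, …, N - 1}` of the segment `{0, …, N}`, for `k < N - 1`. -/
def site (k : Fin (N - 1)) : Fin (N + 1) := ⟨k.1 + 1, by omega⟩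

/-- Its left neighbour. -/
def siteL (k : Fin (N - 1)) : Fin (N + 1) := ⟨k.1, by omega⟩

/-- Its right neighbour. -/
def siteR (k : Fin (N - 1)) : Fin (N + 1) := ⟨k.1 + 2, by omega⟩

theorem site_ne_zero (k : Fin (N - 1)) : (0 : Fin (N + 1)) ≠ site k := by
  intro h
  have := congrArg Fin.val h
  simp [site] at this

theorem site_ne_last (k : Fin (N - 1)) : Fin.last N ≠ site k := by
  intro h
  have := congrArg Fin.val h
  simp [site] at this
  omega

/-- The Hamiltonian `∑_{i=1}^N V (x_i - x_{i-1})`. -/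
noncomputable def hamiltonian (V : ℝ → ℝ) (x : Omega N) : ℝ :=
  ∑ i : Fin N, V (x.1 i.succ - x.1 i.castSucc)

/-- The interface with interior heights `(x_1, …, x_{N-1}) = (y_0, …, y_{N-2})`. -/
noncomputable def ofInterior (y : Fin (N - 1) → ℝ) : Omega N :=
  ⟨fun i => if h : 1 ≤ i.1 ∧ i.1 < N then y ⟨i.1 - 1, by omega⟩ else 0, by simp, by simp⟩

/-- The equilibrium measure `π_N`: its density with respect to `dx_1 ⋯ dx_{N-1}` is
`exp (-H) / Z_N`. -/
noncomputable def equilibrium (V : ℝ → ℝ) (N : ℕ) : Measure (Omega N) :=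
  ((volume : Measure (Fin (N - 1) → ℝ)).withDensity fun y =>
    ENNReal.ofReal (Real.exp (-hamiltonian V (ofInterior y)) /
      ∫ z : Fin (N - 1) → ℝ, Real.exp (-hamiltonian V (ofInterior z)))).map ofInterior

/-- The conditional equilibrium density `ρ_{b,c}` of a height whose neighbours have heights
`b` and `c`. -/
noncomputable def rho (V : ℝ → ℝ) (b c u : ℝ) : ℝ :=
  Real.exp (-V (u - b) - V (c - u)) / ∫ s, Real.exp (-V (s - b) - V (c - s))

/-- The configuration `x^{(k,u)}`: the height at an interior site is replaced by `u`. -/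
def setHeight (x : Omega N) (k : Fin (N - 1)) (u : ℝ) : Omega N :=
  ⟨Function.update x.1 (site k) u, by
    rw [Function.update_of_ne (site_ne_zero k), Function.update_of_ne (site_ne_last k)]
    exact x.2⟩

/-- The kernel sending `(b, c)` to the probability measure with density `ρ_{b,c}`. -/
noncomputable def rhoKernel (V : ℝ → ℝ) : Kernel (ℝ × ℝ) ℝ :=
  Kernel.withDensity (Kernel.const (ℝ × ℝ) volume) fun p u => ENNReal.ofReal (rho V p.1 p.2 u)

theorem measurable_neighbours (k : Fin (N - 1)) :
    Measurable fun x : Omega N => (x.1 (siteL k), x.1 (siteR k)) := by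
  exact ((measurable_pi_apply _).comp measurable_subtype_coe).prodMk
    ((measurable_pi_apply _).comp measurable_subtype_coe)

/-- The heat-bath update `𝒬_k` at an interior site, as a transition kernel: the height at the
site is resampled from `ρ_{b,c}`, where `b` and `c` are the neighbouring heights. -/
noncomputable def heatBath (V : ℝ → ℝ) (k : Fin (N - 1)) : Kernel (Omega N) (Omega N) :=
  (Kernel.id ×ₖ (rhoKernel V).comap _ (measurable_neighbours k)).map
    fun p => setHeight p.1 k p.2

/-- The sum `∑_{k=1}^{N-1} 𝒬_k`. The generator of the Gibbs sampler is this sum minus `N - 1`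
times the identity. -/
noncomputable def updateSum (V : ℝ → ℝ) (N : ℕ) : Kernel (Omega N) (Omega N) :=
  ∑ k : Fin (N - 1), heatBath V k

/-- The `n`-th power of `∑_k 𝒬_k`. -/
noncomputable def updatePow (V : ℝ → ℝ) (N : ℕ) : ℕ → Kernel (Omega N) (Omega N)
  | 0 => Kernel.id
  | n + 1 => updateSum V N ∘ₖ updatePow V N n

/-- The law `P_t^x` (for `t ≥ 0`) of the Gibbs sampler started from `x`, that is `exp (t 𝓛)` with
the bounded generator `𝓛 = ∑_k (𝒬_k - 1)`:
`P_t^x = e^{-(N-1)t} ∑_n (t^n / n!) (∑_k 𝒬_k)^n (x, ·)`. Equivalently, every interior site carries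
an independent rate one Poisson clock and undergoes a heat-bath update when its clock rings. -/
noncomputable def law (V : ℝ → ℝ) (x : Omega N) (t : ℝ) : Measure (Omega N) :=
  Measure.sum fun n : ℕ =>
    ENNReal.ofReal (Real.exp (-((N - 1 : ℕ) : ℝ) * t) * (t ^ n / (n.factorial : ℝ))) •
      updatePow V N n x

/-- Total variation distance, the supremum of `μ B - ν B` over measurable sets `B`
(a supremum of a nonempty set that is bounded above when `μ` is finite). -/
noncomputable def tvDist {α : Type*} [MeasurableSpace α] (μ ν : Measure α) : ℝ :=
  ⨆ B : {B : Set α // MeasurableSet B}, (μ.real B - ν.real B)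

/-- The worst-case distance to equilibrium `d_N(t)` over initial conditions of absolute height at
most `N`. -/
noncomputable def worstDist (V : ℝ → ℝ) (N : ℕ) (t : ℝ) : ℝ :=
  ⨆ x : {x : Omega N // ∀ i, |x.1 i| ≤ (N : ℝ)}, tvDist (law V x.1 t) (equilibrium V N)

/-- The mixing time `T_N(ε) = inf {t ≥ 0 : d_N(t) < ε}`, with `inf ∅ = +∞`. -/
noncomputable def mixingTime (V : ℝ → ℝ) (N : ℕ) (ε : ℝ) : EReal :=
  ⨅ t ∈ {t : ℝ | 0 ≤ t ∧ worstDist V N t < ε}, (t : EReal)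

/-- The relaxation rate `λ_N = 1 - cos (π / N)`. -/
noncomputable def rate (N : ℕ) : ℝ := 1 - Real.cos (Real.pi / N)

end GradPhi

namespace GradPhi

/-! ### Slopes of the potential -/

/-! The distance is detected by one linear statistic, f(x) = ∑ sin(πa/N) x_a (`sineStat`), for the
chain started from the profile x_a = N sin(πa/N). Reflection about (b+c)/2 preserves ρ_{b,c}, so an
update replaces a mean height by the average of its neighbours. The mean profile thus solves the
discrete heat equation, of which the sine is an eigenfunction: f has mean m = e^{-λ_N t} N²/2 at
time t and mean 0 at equilibrium. If the fluctuations of f are bounded by S = O(N³) under both laws,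
uniformly in t, then `le_tvDist_of_moments` gives 1 - 1/(1 + m²/(4S)), and m²/S is of order N
e^{-2λ_N t}.

The work is the bound S. As V need not be strictly convex, the conditional variance of a height may
grow like (c-b)²; it is at most 3/16 (c-b)² + C (`Admissible.exists_integral_weight_sq_le`). What
matters is 3/16 < 1/4: the conditional second moment is then at most 7/16 b² + 7/16 c² + 1/8 bc + C,
with nonnegative weights of total 1 and a positive weight on bc. Hence the second moments E[x_a x_b]
obey a closed linear system, exact off the diagonal and an inequality on it, like a two-particle
walk with a source on the diagonal. The Brownian bridge covariance is harmonic off the diagonal and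
drops by at least 1/8 on it (`bridge_harmonic`, `bridge_diag`); with 1/4 in place of 3/16 the drop
would only be 1/N. So 8 · source · bridge is a supersolution, and it dominates the fluctuations
along the chain by induction on the number of updates (`Admissible.secondMoment_updatePow_le`) and
at equilibrium by a maximum principle (`le_bridge_of_subharmonic`). Its entries are O(N), and the
sine weights are nonnegative, so summing over the pairs of sites gives O(N³). -/

theorem exists_slope_bound {V : ℝ → ℝ} (hV : ConvexOn ℝ univ V) {a b : ℝ} (hab : a < b)
    (h : ∀ᶠ x in atTop, b < V x / x) :
    ∃ R : ℝ, ∀ S, R ≤ S → ∀ y z, S ≤ y → y ≤ z → a * (z - y) ≤ V z - V y := by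
  obtain ⟨R₀, hR₀⟩ := eventually_atTop.1 h
  refine ⟨max (max R₀ 1) (|V 0| / (b - a)), fun S hS y z hy hyz => ?_⟩
  rcases hyz.eq_or_lt with rfl | hyz
  · simp
  have hSy : max (max R₀ 1) (|V 0| / (b - a)) ≤ y := hS.trans hy
  have h1 : (1 : ℝ) ≤ y := (le_max_right R₀ 1).trans ((le_max_left _ _).trans hSy)
  have h2 : R₀ ≤ y := (le_max_left R₀ 1).trans ((le_max_left _ _).trans hSy)
  have h3 : |V 0| / (b - a) ≤ y := (le_max_right _ _).trans hSy
  have hy0 : 0 < y := by linarith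
  -- The slope over [y, z] is at least the slope over [0, y], which exceeds b - |V 0|/y ≥ a.
  have h4 := hV.slope_mono_adjacent (mem_univ 0) (mem_univ z) hy0 hyz
  have h5 := hR₀ y h2
  rw [lt_div_iff₀ hy0] at h5
  rw [div_le_iff₀ (sub_pos.2 hab)] at h3
  have h6 : a ≤ (V y - V 0) / (y - 0) := by
    rw [sub_zero, le_div_iff₀ hy0]
    nlinarith [le_abs_self (V 0)]
  have h7 := h6.trans h4
  rwa [le_div_iff₀ (sub_pos.2 hyz)] at h7

/-- The tilt m separates the two asymptotic slopes, finite or not. It later cancels, in V(h+w) +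
V(h-w) and in the Hamiltonian, whose increments sum to zero; only δ remains, as a rate of decay. -/
theorem Admissible.exists_slopes {V : ℝ → ℝ} (hV : Admissible V) :
    ∃ m δ R : ℝ, 0 < δ ∧ 0 < R ∧
      (∀ y z, R ≤ y → y ≤ z → (m + δ) * (z - y) ≤ V z - V y) ∧
      (∀ y z, R ≤ y → y ≤ z → (-m + δ) * (z - y) ≤ V (-z) - V (-y)) := by
  obtain ⟨s₁, s₂, h₁, h₂, hs⟩ := hV.nonaffine
  obtain ⟨m₁, hm₁, hm₁'⟩ := EReal.lt_iff_exists_real_btwn.1 hs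
  obtain ⟨m₂, hm₂, hm₂'⟩ := EReal.lt_iff_exists_real_btwn.1 hm₁'
  have h12 : m₁ < m₂ := by exact_mod_cast hm₂
  have e₂ : ∀ᶠ x in atTop, m₂ < V x / x := by
    filter_upwards [h₂.eventually (lt_mem_nhds hm₂')] with x hx
    exact_mod_cast hx
  have e₁ : ∀ᶠ x in atTop, -m₁ < V (-x) / x := by
    have h3 : ∀ᶠ x in atBot, V x / x < m₁ := by
      filter_upwards [h₁.eventually (gt_mem_nhds hm₁)] with x hx
      exact_mod_cast hx
    filter_upwards [tendsto_neg_atTop_atBot.eventually h3] with x hx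
    rw [div_neg] at hx
    linarith
  have hV' : ConvexOn ℝ univ fun x => V (-x) := by
    have := hV.convex.comp_linearMap (-LinearMap.id : ℝ →ₗ[ℝ] ℝ)
    simpa [Function.comp_def] using this
  obtain ⟨R₁, hR₁⟩ := exists_slope_bound (V := fun x => V (-x)) hV'
    (a := -((m₁ + m₂) / 2) + (m₂ - m₁) / 4) (by linarith) e₁
  obtain ⟨R₂, hR₂⟩ := exists_slope_bound hV.convex
    (a := (m₁ + m₂) / 2 + (m₂ - m₁) / 4) (by linarith) e₂
  refine ⟨(m₁ + m₂) / 2, (m₂ - m₁) / 4, max 1 (max R₁ R₂), by linarith,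
    by positivity, fun y z hy hyz => ?_, fun y z hy hyz => ?_⟩
  · exact hR₂ _ ((le_max_right _ _).trans (le_max_right _ _)) y z hy hyz
  · exact hR₁ _ ((le_max_left _ _).trans (le_max_right _ _)) y z hy hyz

theorem Admissible.continuous {V : ℝ → ℝ} (hV : Admissible V) : Continuous V :=
  continuousOn_univ.1 (hV.convex.continuousOn isOpen_univ)

/-- After removing a linear part, an admissible potential grows at least linearly. -/
theorem Admissible.exists_linear_growth {V : ℝ → ℝ} (hV : Admissible V) :
    ∃ m δ C : ℝ, 0 < δ ∧ ∀ x, m * x + δ * |x| - C ≤ V x := by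
  obtain ⟨m, δ, R, hδ, hR, hr, hl⟩ := hV.exists_slopes
  obtain ⟨x₀, -, hx₀⟩ := (isCompact_Icc (a := -R) (b := R)).exists_isMinOn
    ⟨0, by constructor <;> linarith⟩ (hV.continuous.sub (continuous_const.mul continuous_id) :
      Continuous fun x => V x - m * x).continuousOn
  set c := V x₀ - m * x₀
  have hc : ∀ x, |x| ≤ R → c ≤ V x - m * x := fun x hx => hx₀ (abs_le.1 hx)
  refine ⟨m, δ, δ * R - c, hδ, fun x => ?_⟩
  rcases le_or_gt |x| R with hx | hx
  · have := hc x hx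
    nlinarith
  · rcases le_or_gt 0 x with h0 | h0
    · rw [abs_of_nonneg h0] at hx ⊢
      have := hr R x le_rfl hx.le
      have := hc R (abs_of_pos hR).le
      nlinarith
    · rw [abs_of_neg h0] at hx ⊢
      have h1 := hl R (-x) le_rfl hx.le
      have := hc (-R) (by rw [abs_neg]; exact (abs_of_pos hR).le)
      rw [neg_neg] at h1
      nlinarith

/-! ### Second moments of even unimodal densities -/

theorem integrable_exp_neg_mul_abs {d : ℝ} (hd : 0 < d) :
    Integrable fun w : ℝ => Real.exp (-(d * |w|)) := by
  have h : Integrable fun w : ℝ => Real.exp ((-d) * |w|) := by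
    rw [← integrableOn_univ, ← Iic_union_Ioi (a := (0 : ℝ))]
    refine IntegrableOn.union ?_ ?_
    · refine (integrableOn_exp_mul_Iic hd 0).congr_fun (fun w hw => ?_) measurableSet_Iic
      simp [abs_of_nonpos (mem_Iic.1 hw)]
    · refine (integrableOn_exp_mul_Ioi (neg_lt_zero.2 hd) 0).congr_fun (fun w hw => ?_)
        measurableSet_Ioi
      simp [abs_of_pos (mem_Ioi.1 hw)]
  simpa using h

/-- This is y²/2 ≤ e^y at y = dx/2. Only half of the rate d is spent, so a weight e^{-dx} keeps the
other half. -/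
theorem sq_le_exp {x d : ℝ} (hx : 0 ≤ x) (hd : 0 < d) :
    x ^ 2 ≤ 8 / d ^ 2 * Real.exp (d * x / 2) := by
  have h := Real.quadratic_le_exp_of_nonneg (x := d * x / 2) (by positivity)
  have h2 : d ^ 2 * x ^ 2 ≤ 8 * Real.exp (d * x / 2) := by nlinarith [mul_nonneg hd.le hx]
  rw [div_mul_eq_mul_div, le_div_iff₀ (by positivity)]
  linarith

theorem integrable_sq_mul_exp_neg_mul_abs {d : ℝ} (hd : 0 < d) :
    Integrable fun w : ℝ => w ^ 2 * Real.exp (-(d * |w|)) := by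
  refine ((integrable_exp_neg_mul_abs (half_pos hd)).const_mul (8 / d ^ 2)).mono'
    (by fun_prop) (Eventually.of_forall fun w => ?_)
  have h := sq_le_exp (abs_nonneg w) hd
  rw [sq_abs] at h
  rw [Real.norm_of_nonneg (by positivity)]
  calc w ^ 2 * Real.exp (-(d * |w|))
      ≤ 8 / d ^ 2 * Real.exp (d * |w| / 2) * Real.exp (-(d * |w|)) := by gcongr
    _ = _ := by rw [mul_assoc, ← Real.exp_add]; ring_nf

/-- A continuous even potential, nondecreasing on `[0, ∞)` and with slope at least `d` beyond `L`. -/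
structure EvenUnimodal (Φ : ℝ → ℝ) (L d : ℝ) : Prop where
  cont : Continuous Φ
  even : ∀ w, Φ (-w) = Φ w
  mono : ∀ v w, 0 ≤ v → v ≤ w → Φ v ≤ Φ w
  tail : ∀ w, L ≤ w → Φ L + d * (w - L) ≤ Φ w

namespace EvenUnimodal

variable {Φ : ℝ → ℝ} {L d : ℝ}

theorem apply_abs (h : EvenUnimodal Φ L d) (w : ℝ) : Φ |w| = Φ w := by
  rcases abs_choice w with h' | h' <;> rw [h']
  exact h.even w

theorem le_apply (h : EvenUnimodal Φ L d) (hL : 0 ≤ L) (hd : 0 < d) (w : ℝ) :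
    Φ 0 + d * (|w| - L) ≤ Φ w := by
  rw [← h.apply_abs w]
  rcases le_or_gt L |w| with hw | hw
  · have := h.tail _ hw
    have := h.mono 0 L le_rfl hL
    linarith
  · have := h.mono 0 |w| le_rfl (abs_nonneg w)
    nlinarith

theorem exp_neg_le (h : EvenUnimodal Φ L d) (hL : 0 ≤ L) (hd : 0 < d) (w : ℝ) :
    Real.exp (-Φ w) ≤ Real.exp (d * L - Φ 0) * Real.exp (-(d * |w|)) := by
  rw [← Real.exp_add, Real.exp_le_exp]
  have := h.le_apply hL hd w
  linarith

theorem integrable_exp (h : EvenUnimodal Φ L d) (hL : 0 ≤ L) (hd : 0 < d) :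
    Integrable fun w => Real.exp (-Φ w) := by
  refine ((integrable_exp_neg_mul_abs hd).const_mul (Real.exp (d * L - Φ 0))).mono'
    (Real.continuous_exp.comp h.cont.neg).aestronglyMeasurable (Eventually.of_forall fun w => ?_)
  rw [Real.norm_of_nonneg (by positivity)]
  exact h.exp_neg_le hL hd w

theorem integrable_sq (h : EvenUnimodal Φ L d) (hL : 0 ≤ L) (hd : 0 < d) :
    Integrable fun w => w ^ 2 * Real.exp (-Φ w) := by
  refine ((integrable_sq_mul_exp_neg_mul_abs hd).const_mul (Real.exp (d * L - Φ 0))).mono'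
    ((continuous_pow 2).mul (Real.continuous_exp.comp h.cont.neg)).aestronglyMeasurable
    (Eventually.of_forall fun w => ?_)
  rw [Real.norm_of_nonneg (by positivity), mul_left_comm]
  exact mul_le_mul_of_nonneg_left (h.exp_neg_le hL hd w) (sq_nonneg w)

theorem integral_id_eq_zero (h : EvenUnimodal Φ L d) :
    ∫ w, w * Real.exp (-Φ w) = 0 := by
  have h1 := integral_neg_eq_self (fun w => w * Real.exp (-Φ w)) volume
  simp only [h.even, neg_mul, integral_neg] at h1
  linarith

/-- The factor w² - L²/2 changes sign at r = L/√2 and exp(-Φ) is nonincreasing on [0, L], so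
freezing exp(-Φ) at r can only increase the integral. What remains is L³/3 - L³/2. -/
theorem setIntegral_center_le (h : EvenUnimodal Φ L d) (hL : 0 < L) :
    ∫ w in Ioc 0 L, (w ^ 2 - L ^ 2 / 2) * Real.exp (-Φ w)
      ≤ -(L ^ 3 / 6) * Real.exp (-Φ (√2⁻¹ * L)) := by
  set r := √2⁻¹ * L
  have hr0 : 0 ≤ r := by positivity
  have hr : r ^ 2 = L ^ 2 / 2 := by
    rw [mul_pow, Real.sq_sqrt (by norm_num)]; ring
  have h1 : ∫ w in Ioc 0 L, (w ^ 2 - L ^ 2 / 2) * Real.exp (-Φ r)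
      = -(L ^ 3 / 6) * Real.exp (-Φ r) := by
    rw [integral_mul_const, ← intervalIntegral.integral_of_le hL.le,
      intervalIntegral.integral_sub (by simp) (by simp), integral_pow]
    simp
    ring
  rw [← h1]
  have hc : Continuous fun w => Real.exp (-Φ w) := Real.continuous_exp.comp h.cont.neg
  refine setIntegral_mono_on ?_ ?_ measurableSet_Ioc fun w hw => ?_
  · exact (Continuous.integrableOn_Icc (by fun_prop)).mono_set Ioc_subset_Icc_self
  · exact (Continuous.integrableOn_Icc (by fun_prop)).mono_set Ioc_subset_Icc_self
  · rw [← hr]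
    rcases le_total w r with hwr | hwr
    · refine mul_le_mul_of_nonpos_left (Real.exp_le_exp.2 (neg_le_neg ?_)) ?_
      · exact h.mono _ _ hw.1.le hwr
      · nlinarith [hw.1]
    · refine mul_le_mul_of_nonneg_left (Real.exp_le_exp.2 (neg_le_neg ?_)) ?_
      · exact h.mono _ _ hr0 hwr
      · nlinarith [hw.1]

theorem setIntegral_exp_shift {a : ℝ} (ha : 0 < a) :
    IntegrableOn (fun w => Real.exp (-(a * (w - L)))) (Ioi L) ∧
      ∫ w in Ioi L, Real.exp (-(a * (w - L))) = 1 / a := by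
  have e : (fun w => Real.exp (-(a * (w - L)))) = fun w => Real.exp (a * L) * Real.exp (-a * w) := by
    funext w
    rw [← Real.exp_add]; ring_nf
  rw [e]
  refine ⟨(integrableOn_exp_mul_Ioi (neg_lt_zero.2 ha) L).const_mul _, ?_⟩
  rw [integral_const_mul, integral_exp_mul_Ioi (neg_lt_zero.2 ha)]
  rw [neg_div_neg_eq, mul_div_assoc', ← Real.exp_add]
  simp

/-- The bound is written in terms of exp(-Φ) at the same point L/√2 as the central one, so that the
two can be compared directly. -/
theorem setIntegral_tail_le (h : EvenUnimodal Φ L d) (hL : 0 < L) (hd : 0 < d) :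
    ∫ w in Ioi L, (w ^ 2 - L ^ 2 / 2) * Real.exp (-Φ w)
      ≤ (2 * L ^ 2 / d + 32 / d ^ 3) * Real.exp (-Φ (√2⁻¹ * L)) := by
  set r := √2⁻¹ * L
  have hr0 : 0 ≤ r := by positivity
  have hrL : r ≤ L := by
    have : √2⁻¹ ≤ 1 := Real.sqrt_le_one.2 (by norm_num)
    exact mul_le_of_le_one_left hL.le this
  obtain ⟨i1, v1⟩ := setIntegral_exp_shift (L := L) hd
  obtain ⟨i2, v2⟩ := setIntegral_exp_shift (L := L) (half_pos hd)
  have hI : IntegrableOn (fun w => (2 * L ^ 2 * Real.exp (-(d * (w - L)))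
      + 16 / d ^ 2 * Real.exp (-(d / 2 * (w - L)))) * Real.exp (-Φ r)) (Ioi L) :=
    ((i1.const_mul _).add (i2.const_mul _)).mul_const _
  have hval : ∫ w in Ioi L, (2 * L ^ 2 * Real.exp (-(d * (w - L)))
      + 16 / d ^ 2 * Real.exp (-(d / 2 * (w - L)))) * Real.exp (-Φ r)
      = (2 * L ^ 2 / d + 32 / d ^ 3) * Real.exp (-Φ r) := by
    rw [integral_mul_const, integral_add (i1.const_mul _) (i2.const_mul _), integral_const_mul,
      integral_const_mul, v1, v2]
    congr 1
    field_simp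
    ring
  rw [← hval]
  refine setIntegral_mono_on ?_ hI measurableSet_Ioi fun w hw => ?_
  · have := ((h.integrable_sq hL.le hd).sub ((h.integrable_exp hL.le hd).const_mul (L ^ 2 / 2)))
    refine (this.congr (Eventually.of_forall fun w => ?_)).integrableOn
    simp only [Pi.sub_apply]
    ring
  · have hw' : L < w := hw
    have h1 : Real.exp (-Φ w) ≤ Real.exp (-(d * (w - L))) * Real.exp (-Φ r) := by
      rw [← Real.exp_add, Real.exp_le_exp]
      have := h.tail w hw'.le
      have := h.mono r L hr0 hrL
      linarith
    have h2 := sq_le_exp (x := w - L) (by linarith) hd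
    have h3 : w ^ 2 - L ^ 2 / 2 ≤ 2 * L ^ 2 + 2 * (w - L) ^ 2 := by
      nlinarith [sq_nonneg (w - 2 * L)]
    have h4 : 0 ≤ w ^ 2 - L ^ 2 / 2 := by nlinarith
    calc (w ^ 2 - L ^ 2 / 2) * Real.exp (-Φ w)
        ≤ (2 * L ^ 2 + 2 * (w - L) ^ 2) * (Real.exp (-(d * (w - L))) * Real.exp (-Φ r)) := by
          gcongr
      _ ≤ (2 * L ^ 2 + 2 * (8 / d ^ 2 * Real.exp (d * (w - L) / 2)))
          * (Real.exp (-(d * (w - L))) * Real.exp (-Φ r)) := by gcongr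
      _ = _ := by
          have : Real.exp (-(d / 2 * (w - L)))
              = Real.exp (d * (w - L) / 2) * Real.exp (-(d * (w - L))) := by
            rw [← Real.exp_add]; ring_nf
          rw [this]; ring

/-- The negative central part absorbs the tail: L d ≥ 24 makes each of the two tail terms at most
L³/12. The factor 1/2, being less than 1, is what brings the conditional variance below (c-b)²/4 to
leading order. -/
theorem integral_sq_le (h : EvenUnimodal Φ L d) (hd : 0 < d) (hL : 24 / d ≤ L) :
    ∫ w, w ^ 2 * Real.exp (-Φ w) ≤ L ^ 2 / 2 * ∫ w, Real.exp (-Φ w) := by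
  have hL0 : 0 < L := lt_of_lt_of_le (by positivity) hL
  have i2 := h.integrable_sq hL0.le hd
  have i0 := (h.integrable_exp hL0.le hd).const_mul (L ^ 2 / 2)
  have hI : Integrable fun w => (w ^ 2 - L ^ 2 / 2) * Real.exp (-Φ w) :=
    (i2.sub i0).congr (Eventually.of_forall fun w => by simp only [Pi.sub_apply]; ring)
  rw [← sub_nonpos, ← integral_const_mul, ← integral_sub i2 i0]
  have e1 : ∫ w, (w ^ 2 * Real.exp (-Φ w) - L ^ 2 / 2 * Real.exp (-Φ w))
      = 2 * ∫ w in Ioi 0, (w ^ 2 - L ^ 2 / 2) * Real.exp (-Φ w) := by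
    rw [← integral_comp_abs (f := fun w => (w ^ 2 - L ^ 2 / 2) * Real.exp (-Φ w))]
    congr 1
    funext w
    rw [sq_abs, h.apply_abs]; ring
  have e2 : ∫ w in Ioi 0, (w ^ 2 - L ^ 2 / 2) * Real.exp (-Φ w)
      = (∫ w in Ioc 0 L, (w ^ 2 - L ^ 2 / 2) * Real.exp (-Φ w))
        + ∫ w in Ioi L, (w ^ 2 - L ^ 2 / 2) * Real.exp (-Φ w) := by
    rw [← Ioc_union_Ioi_eq_Ioi hL0.le, setIntegral_union (Ioc_disjoint_Ioi le_rfl)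
      measurableSet_Ioi hI.integrableOn hI.integrableOn]
  rw [e1, e2]
  have b1 := h.setIntegral_center_le hL0
  have b2 := h.setIntegral_tail_le hL0 hd
  have b3 : 2 * L ^ 2 / d + 32 / d ^ 3 ≤ L ^ 3 / 6 := by
    have h1 : 24 ≤ L * d := by rwa [div_le_iff₀ hd] at hL
    have h2 : 2 * L ^ 2 / d ≤ L ^ 3 / 12 := by
      rw [div_le_div_iff₀ hd (by norm_num)]
      nlinarith [sq_nonneg L, mul_le_mul_of_nonneg_left h1 (sq_nonneg L)]
    have h3 : 32 / d ^ 3 ≤ L ^ 3 / 12 := by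
      rw [div_le_div_iff₀ (by positivity) (by norm_num), ← mul_pow]
      have : (24 : ℝ) ^ 3 ≤ (L * d) ^ 3 := by gcongr
      linarith
    linarith
  have b4 := mul_le_mul_of_nonneg_right b3 (Real.exp_pos (-Φ (√2⁻¹ * L))).le
  linarith

end EvenUnimodal

/-! ### The conditional distribution of a height given its neighbours -/

variable {V : ℝ → ℝ}

theorem evenUnimodal_pair {m δ R h L : ℝ} (hV : ConvexOn ℝ univ V) (hc : Continuous V)
    (hr : ∀ y z, R ≤ y → y ≤ z → (m + δ) * (z - y) ≤ V z - V y)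
    (hl : ∀ y z, R ≤ y → y ≤ z → (-m + δ) * (z - y) ≤ V (-z) - V (-y))
    (hL : |h| + R ≤ L) :
    EvenUnimodal (fun w => V (h + w) + V (h - w)) L (2 * δ) where
  cont := by fun_prop
  even w := by rw [sub_neg_eq_add, ← sub_eq_add_neg, add_comm]
  mono v w hv hvw := by
    rcases hvw.eq_or_lt with rfl | hvw
    · exact le_rfl
    have hw : 0 < w := hv.trans_lt hvw
    -- The points h ± v are convex combinations of h ± w with weights (w+v)/(2w) and (w-v)/(2w).
    have ha : 0 ≤ (w + v) / (2 * w) := by positivity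
    have hb : 0 ≤ (w - v) / (2 * w) := div_nonneg (by linarith) (by linarith)
    have hab : (w + v) / (2 * w) + (w - v) / (2 * w) = 1 := by field_simp; ring
    have h1 := hV.2 (mem_univ (h + w)) (mem_univ (h - w)) ha hb hab
    have h2 := hV.2 (mem_univ (h - w)) (mem_univ (h + w)) ha hb hab
    simp only [smul_eq_mul] at h1 h2
    have e1 : (w + v) / (2 * w) * (h + w) + (w - v) / (2 * w) * (h - w) = h + v := by
      field_simp; ring
    have e2 : (w + v) / (2 * w) * (h - w) + (w - v) / (2 * w) * (h + w) = h - v := by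
      field_simp; ring
    rw [e1] at h1
    rw [e2] at h2
    calc _ ≤ ((w + v) / (2 * w) + (w - v) / (2 * w)) * (V (h + w) + V (h - w)) := by linarith
      _ = _ := by rw [hab, one_mul]
  tail w hw := by
    -- As L ≥ |h| + R, the point h + L lies beyond R and h - L below -R; the slopes m + δ and -m + δ
    -- add up to 2δ.
    have h1 := hr (h + L) (h + w) (by linarith [neg_abs_le h]) (by linarith)
    have h2 := hl (L - h) (w - h) (by linarith [le_abs_self h]) (by linarith)
    rw [neg_sub, neg_sub] at h2
    linarith

/-- The unnormalised conditional density, centred at the mean of the two neighbours. -/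
theorem Admissible.exists_evenUnimodal (hV : Admissible V) :
    ∃ d R : ℝ, 0 < d ∧ 24 / d ≤ R ∧
      ∀ h, EvenUnimodal (fun w => V (h + w) + V (h - w)) (|h| + R) d := by
  obtain ⟨m, δ, R, hδ, hR, hr, hl⟩ := hV.exists_slopes
  exact ⟨2 * δ, max R (24 / (2 * δ)), by positivity, le_max_right _ _, fun h =>
    evenUnimodal_pair hV.convex hV.continuous hr hl (by gcongr; exact le_max_left _ _)⟩

theorem weight_center (b c w : ℝ) :
    Real.exp (-V ((b + c) / 2 + w - b) - V (c - ((b + c) / 2 + w)))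
      = Real.exp (-(V ((c - b) / 2 + w) + V ((c - b) / 2 - w))) := by
  rw [show (b + c) / 2 + w - b = (c - b) / 2 + w by ring,
    show c - ((b + c) / 2 + w) = (c - b) / 2 - w by ring, neg_add']

theorem integral_weight (b c : ℝ) (φ : ℝ → ℝ) :
    ∫ u, φ u * Real.exp (-V (u - b) - V (c - u))
      = ∫ w, φ ((b + c) / 2 + w) * Real.exp (-(V ((c - b) / 2 + w) + V ((c - b) / 2 - w))) := by
  rw [← integral_add_left_eq_self _ ((b + c) / 2)]
  simp only [weight_center]

theorem integrable_weight_iff (b c : ℝ) (φ : ℝ → ℝ) :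
    Integrable (fun u => φ u * Real.exp (-V (u - b) - V (c - u)))
      ↔ Integrable fun w => φ ((b + c) / 2 + w) *
          Real.exp (-(V ((c - b) / 2 + w) + V ((c - b) / 2 - w))) := by
  rw [← (measurePreserving_add_left volume ((b + c) / 2)).integrable_comp_emb
    (measurableEmbedding_addLeft ((b + c) / 2))]
  simp only [Function.comp_def, weight_center]

theorem Admissible.integrable_weight (hV : Admissible V) (b c : ℝ) :
    Integrable fun u => Real.exp (-V (u - b) - V (c - u)) := by
  obtain ⟨d, R, hd, hR, h⟩ := hV.exists_evenUnimodal
  have hR0 : 0 < R := lt_of_lt_of_le (by positivity) hR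
  have := (integrable_weight_iff (V := V) b c fun _ => 1).2
    (by simpa using (h ((c - b) / 2)).integrable_exp (by positivity) hd)
  simpa using this

theorem Admissible.integral_weight_pos (hV : Admissible V) (b c : ℝ) :
    0 < ∫ u, Real.exp (-V (u - b) - V (c - u)) :=
  integral_exp_pos (hV.integrable_weight b c)

theorem Admissible.integrable_weight_sq (hV : Admissible V) (b c : ℝ) :
    Integrable fun u => u ^ 2 * Real.exp (-V (u - b) - V (c - u)) := by
  obtain ⟨d, R, hd, hR, h⟩ := hV.exists_evenUnimodal
  have hR0 : 0 < R := lt_of_lt_of_le (by positivity) hR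
  have i0 := (h ((c - b) / 2)).integrable_exp (by positivity) hd
  have i2 := (h ((c - b) / 2)).integrable_sq (by positivity) hd
  refine (integrable_weight_iff (V := V) b c fun u => u ^ 2).2 ?_
  refine ((i0.const_mul (2 * ((b + c) / 2) ^ 2)).add (i2.const_mul 2)).mono' ?_
    (Eventually.of_forall fun w => ?_)
  · have := hV.continuous
    fun_prop
  · rw [Real.norm_of_nonneg (by positivity)]
    simp only [Pi.add_apply]
    rw [← mul_assoc, ← add_mul]
    gcongr
    nlinarith [sq_nonneg ((b + c) / 2 - w)]

/-- With L = |c-b|/2 + R, the bound L²/2 has leading term (c-b)²/8 = 2/16 (c-b)². The additional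
1/16 and the constant absorb the cross term |c-b| R/2. -/
theorem Admissible.exists_integral_weight_sq_le (hV : Admissible V) :
    ∃ C : ℝ, 0 ≤ C ∧ ∀ b c, ∫ u, (u - (b + c) / 2) ^ 2 * Real.exp (-V (u - b) - V (c - u))
      ≤ (3 / 16 * (c - b) ^ 2 + C) * ∫ u, Real.exp (-V (u - b) - V (c - u)) := by
  obtain ⟨d, R, hd, hR, h⟩ := hV.exists_evenUnimodal
  have hR0 : 0 < R := lt_of_lt_of_le (by positivity) hR
  refine ⟨3 / 2 * R ^ 2, by positivity, fun b c => ?_⟩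
  have e0 := integral_weight (V := V) b c fun _ => 1
  simp only [one_mul] at e0
  rw [integral_weight (V := V) b c fun u => (u - (b + c) / 2) ^ 2, e0]
  simp only [add_sub_cancel_left]
  refine ((h ((c - b) / 2)).integral_sq_le hd
    (hR.trans (le_add_of_nonneg_left (abs_nonneg _)))).trans ?_
  gcongr
  have e : (c - b) ^ 2 = 4 * |(c - b) / 2| ^ 2 := by rw [sq_abs]; ring
  rw [e]
  nlinarith [sq_nonneg (|(c - b) / 2| - 2 * R)]

theorem Admissible.integral_weight_id (hV : Admissible V) (b c : ℝ) :
    ∫ u, (u - (b + c) / 2) * Real.exp (-V (u - b) - V (c - u)) = 0 := by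
  obtain ⟨d, R, hd, hR, h⟩ := hV.exists_evenUnimodal
  rw [integral_weight (V := V) b c fun u => u - (b + c) / 2]
  simp only [add_sub_cancel_left]
  exact (h ((c - b) / 2)).integral_id_eq_zero

theorem Admissible.measurable_rho (hV : Admissible V) :
    Measurable (Function.uncurry fun (p : ℝ × ℝ) u => ENNReal.ofReal (rho V p.1 p.2 u)) := by
  have hc := hV.continuous
  have h1 : Continuous fun q : (ℝ × ℝ) × ℝ =>
      Real.exp (-V (q.2 - q.1.1) - V (q.1.2 - q.2)) := by fun_prop
  have h2 : StronglyMeasurable fun p : ℝ × ℝ =>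
      ∫ u, Real.exp (-V (u - p.1) - V (p.2 - u)) :=
    h1.stronglyMeasurable.integral_prod_right
  exact (h1.measurable.div (h2.measurable.comp measurable_fst)).ennreal_ofReal

theorem Admissible.rhoKernel_apply (hV : Admissible V) (b c : ℝ) :
    rhoKernel V (b, c) = volume.withDensity fun u => ENNReal.ofReal (rho V b c u) := by
  rw [rhoKernel, Kernel.withDensity_apply _ hV.measurable_rho, Kernel.const_apply]

theorem rho_nonneg (b c u : ℝ) : 0 ≤ rho V b c u :=
  div_nonneg (Real.exp_pos _).le (integral_nonneg fun _ => (Real.exp_pos _).le)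

theorem Admissible.measurable_rho_right (hV : Admissible V) (b c : ℝ) :
    Measurable fun u => ENNReal.ofReal (rho V b c u) :=
  hV.measurable_rho.comp (measurable_prodMk_left (x := (b, c)))

theorem Admissible.integral_rhoKernel (hV : Admissible V) (b c : ℝ) (φ : ℝ → ℝ) :
    ∫ u, φ u ∂rhoKernel V (b, c) = (∫ u, φ u * Real.exp (-V (u - b) - V (c - u)))
      / ∫ u, Real.exp (-V (u - b) - V (c - u)) := by
  rw [hV.rhoKernel_apply, integral_withDensity_eq_integral_toReal_smul
    (hV.measurable_rho_right b c) (by simp), ← integral_div]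
  congr 1
  funext u
  rw [ENNReal.toReal_ofReal (rho_nonneg b c u), rho, smul_eq_mul]
  ring

theorem Admissible.integrable_rhoKernel (hV : Admissible V) (b c : ℝ) {φ : ℝ → ℝ}
    (h : Integrable fun u => φ u * Real.exp (-V (u - b) - V (c - u))) :
    Integrable φ (rhoKernel V (b, c)) := by
  rw [hV.rhoKernel_apply, integrable_withDensity_iff_integrable_smul'
    (hV.measurable_rho_right b c) (by simp)]
  refine (h.div_const (∫ u, Real.exp (-V (u - b) - V (c - u)))).congr
    (Eventually.of_forall fun u => ?_)
  simp only [smul_eq_mul]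
  rw [ENNReal.toReal_ofReal (rho_nonneg b c u), rho]
  ring

theorem Admissible.isMarkovKernel_rhoKernel (hV : Admissible V) : IsMarkovKernel (rhoKernel V) := by
  refine ⟨fun ⟨b, c⟩ => ⟨?_⟩⟩
  rw [hV.rhoKernel_apply, withDensity_apply _ MeasurableSet.univ, Measure.restrict_univ]
  simp only [rho]
  rw [← ofReal_integral_eq_lintegral_ofReal ((hV.integrable_weight b c).div_const _)
      (Eventually.of_forall (rho_nonneg b c))]
  rw [integral_div, div_self (hV.integral_weight_pos b c).ne', ENNReal.ofReal_one]

theorem Admissible.integrable_sq_rhoKernel (hV : Admissible V) (b c : ℝ) :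
    Integrable (fun u => u ^ 2) (rhoKernel V (b, c)) :=
  hV.integrable_rhoKernel b c (hV.integrable_weight_sq b c)

theorem Admissible.integrable_id_rhoKernel (hV : Admissible V) (b c : ℝ) :
    Integrable (fun u => u) (rhoKernel V (b, c)) := by
  have := hV.isMarkovKernel_rhoKernel
  exact ((memLp_two_iff_integrable_sq aestronglyMeasurable_id).2
    (hV.integrable_sq_rhoKernel b c)).integrable (by norm_num)

theorem Admissible.integral_id_rhoKernel (hV : Admissible V) (b c : ℝ) :
    ∫ u, u ∂rhoKernel V (b, c) = (b + c) / 2 := by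
  have := hV.isMarkovKernel_rhoKernel
  have h := hV.integral_rhoKernel b c fun u => u - (b + c) / 2
  rw [hV.integral_weight_id, zero_div, integral_sub (hV.integrable_id_rhoKernel b c)
    (integrable_const _), integral_const] at h
  simp at h
  linarith

/-- Adding the squared mean (b+c)²/4 to 3/16 (c-b)² gives 7/16 = 1/4 + 3/16 and 1/8 = 1/2 - 3/8. -/
theorem Admissible.exists_integral_sq_rhoKernel_le (hV : Admissible V) :
    ∃ C : ℝ, 0 ≤ C ∧ ∀ b c, ∫ u, u ^ 2 ∂rhoKernel V (b, c)
      ≤ 7 / 16 * b ^ 2 + 7 / 16 * c ^ 2 + 1 / 8 * (b * c) + C := by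
  have := hV.isMarkovKernel_rhoKernel
  obtain ⟨C, hC, h⟩ := hV.exists_integral_weight_sq_le
  refine ⟨C, hC, fun b c => ?_⟩
  have i1 := hV.integrable_id_rhoKernel b c
  have i2 := hV.integrable_sq_rhoKernel b c
  have h1 := hV.integral_rhoKernel b c fun u => (u - (b + c) / 2) ^ 2
  have h2 := (div_le_iff₀ (hV.integral_weight_pos b c)).2 (h b c)
  rw [← h1] at h2
  have e : ∀ u, (u - (b + c) / 2) ^ 2 = u ^ 2 - (b + c) * u + ((b + c) / 2) ^ 2 := fun u => by ring
  simp only [e] at h2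
  have i3 : Integrable (fun u => u ^ 2 - (b + c) * u) (rhoKernel V (b, c)) :=
    i2.sub (i1.const_mul _)
  rw [integral_add i3 (integrable_const _), integral_sub i2 (i1.const_mul _), integral_const_mul, hV.integral_id_rhoKernel,
    integral_const] at h2
  simp at h2
  nlinarith

variable {N : ℕ}

/-! ### One heat-bath update -/

theorem site_injective : Function.Injective (site (N := N)) := by
  intro i j h
  have := congrArg Fin.val h
  simp only [site] at this
  exact Fin.ext (by omega)

theorem eq_zero_or_eq_last_or_eq_site (a : Fin (N + 1)) :
    a = 0 ∨ a = Fin.last N ∨ ∃ k : Fin (N - 1), a = site k := by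
  by_cases h0 : a.1 = 0
  · exact Or.inl (Fin.ext h0)
  by_cases hN : a.1 = N
  · exact Or.inr (Or.inl (Fin.ext hN))
  · exact Or.inr (Or.inr ⟨⟨a.1 - 1, by omega⟩, Fin.ext (by simp only [site]; omega)⟩)

theorem setHeight_apply (x : Omega N) (k : Fin (N - 1)) (u : ℝ) (a : Fin (N + 1)) :
    (setHeight x k u).1 a = if a = site k then u else x.1 a := by
  simp only [setHeight, Function.update_apply]

theorem measurable_coord (a : Fin (N + 1)) : Measurable fun x : Omega N => x.1 a :=
  (measurable_pi_apply a).comp measurable_subtype_coe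

theorem measurable_coord_mul (a b : Fin (N + 1)) :
    Measurable fun x : Omega N => x.1 a * x.1 b :=
  (measurable_coord a).mul (measurable_coord b)

theorem measurable_setHeight_uncurry (k : Fin (N - 1)) :
    Measurable fun p : Omega N × ℝ => setHeight p.1 k p.2 := by
  refine Measurable.subtype_mk (measurable_pi_iff.2 fun a => ?_)
  simp only [Function.update_apply]
  split_ifs
  · exact measurable_snd
  · exact (measurable_coord a).comp measurable_fst

theorem measurable_setHeight (x : Omega N) (k : Fin (N - 1)) :
    Measurable fun u : ℝ => setHeight x k u :=
  (measurable_setHeight_uncurry k).comp measurable_prodMk_left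

theorem Admissible.heatBath_apply (hV : Admissible V) (k : Fin (N - 1)) (x : Omega N) :
    heatBath V k x
      = (rhoKernel V (x.1 (siteL k), x.1 (siteR k))).map fun u => setHeight x k u := by
  have := hV.isMarkovKernel_rhoKernel
  rw [heatBath, Kernel.map_apply _ (measurable_setHeight_uncurry k), Kernel.prod_apply,
    Kernel.id_apply, Kernel.comap_apply, Measure.dirac_prod,
    Measure.map_map (measurable_setHeight_uncurry k) measurable_prodMk_left]
  rfl

theorem Admissible.isMarkovKernel_heatBath (hV : Admissible V) (k : Fin (N - 1)) :
    IsMarkovKernel (heatBath V k) := by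
  have := hV.isMarkovKernel_rhoKernel
  exact ⟨fun x => by
    rw [hV.heatBath_apply]
    exact Measure.isProbabilityMeasure_map (measurable_setHeight x k).aemeasurable⟩

theorem Admissible.integral_heatBath (hV : Admissible V) (k : Fin (N - 1)) (x : Omega N)
    {φ : Omega N → ℝ} (hφ : Measurable φ) :
    ∫ z, φ z ∂heatBath V k x
      = ∫ u, φ (setHeight x k u) ∂rhoKernel V (x.1 (siteL k), x.1 (siteR k)) := by
  rw [hV.heatBath_apply, integral_map (measurable_setHeight x k).aemeasurable
    hφ.aestronglyMeasurable]

theorem Admissible.integrable_sq_heatBath (hV : Admissible V) (k : Fin (N - 1)) (x : Omega N)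
    (a : Fin (N + 1)) : Integrable (fun z : Omega N => z.1 a ^ 2) (heatBath V k x) := by
  have := hV.isMarkovKernel_rhoKernel
  rw [hV.heatBath_apply, integrable_map_measure
    ((measurable_coord a).pow_const 2).aestronglyMeasurable (measurable_setHeight x k).aemeasurable]
  simp only [Function.comp_def, setHeight_apply]
  split_ifs
  · exact hV.integrable_sq_rhoKernel _ _
  · exact integrable_const _

/-- The mean of the heights of the two neighbours. -/
noncomputable def nbrMean (x : Omega N) (k : Fin (N - 1)) : ℝ :=
  (x.1 (siteL k) + x.1 (siteR k)) / 2

theorem Admissible.integral_coord_heatBath (hV : Admissible V) (k : Fin (N - 1)) (x : Omega N)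
    (i : Fin (N - 1)) :
    ∫ z, z.1 (site i) ∂heatBath V k x
      = x.1 (site i) + if k = i then nbrMean x i - x.1 (site i) else 0 := by
  have := hV.isMarkovKernel_rhoKernel
  rw [hV.integral_heatBath k x (measurable_coord _)]
  simp only [setHeight_apply, site_injective.eq_iff]
  by_cases h : k = i
  · subst h
    simp only [if_true, hV.integral_id_rhoKernel, nbrMean]
    ring
  · simp [h, Ne.symm h]

theorem Admissible.integral_mul_heatBath (hV : Admissible V) (k : Fin (N - 1)) (x : Omega N)
    {i : Fin (N - 1)} {b : Fin (N + 1)} (hb : b ≠ site i) (h : k = i) :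
    ∫ z, z.1 (site i) * z.1 b ∂heatBath V k x = nbrMean x i * x.1 b := by
  subst h
  rw [hV.integral_heatBath k x (measurable_coord_mul _ _)]
  simp only [setHeight_apply, if_true, hb, if_false]
  rw [integral_mul_const, hV.integral_id_rhoKernel, nbrMean]

theorem Admissible.integral_mul_heatBath_of_ne (hV : Admissible V) (k : Fin (N - 1)) (x : Omega N)
    {a b : Fin (N + 1)} (ha : a ≠ site k) (hb : b ≠ site k) :
    ∫ z, z.1 a * z.1 b ∂heatBath V k x = x.1 a * x.1 b := by
  have := hV.isMarkovKernel_rhoKernel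
  rw [hV.integral_heatBath k x (measurable_coord_mul _ _)]
  simp [setHeight_apply, ha, hb]

theorem Admissible.integral_site_mul_site_heatBath (hV : Admissible V) (k : Fin (N - 1))
    (x : Omega N) {i j : Fin (N - 1)} (hij : i ≠ j) :
    ∫ z, z.1 (site i) * z.1 (site j) ∂heatBath V k x = x.1 (site i) * x.1 (site j)
      + (if k = i then (nbrMean x i - x.1 (site i)) * x.1 (site j) else 0)
      + if k = j then (nbrMean x j - x.1 (site j)) * x.1 (site i) else 0 := by
  have hs : site j ≠ site i := fun h => hij (site_injective h).symm
  by_cases h : k = i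
  · have hj : k ≠ j := fun h' => hij (h.symm.trans h')
    rw [hV.integral_mul_heatBath k x hs h, if_pos h, if_neg hj]
    ring
  · by_cases h' : k = j
    · have e : ∀ z : Omega N, z.1 (site i) * z.1 (site j) = z.1 (site j) * z.1 (site i) :=
        fun z => mul_comm _ _
      simp only [e]
      rw [hV.integral_mul_heatBath k x hs.symm h', if_pos h', if_neg h]
      ring
    · rw [hV.integral_mul_heatBath_of_ne k x (fun e => h (site_injective e).symm)
        (fun e => h' (site_injective e).symm), if_neg h, if_neg h']
      ring

/-- A quadratic form in the neighbours' heights which dominates, up to a constant, the conditional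
second moment of a height. -/
noncomputable def nbrForm (x : Omega N) (k : Fin (N - 1)) : ℝ :=
  7 / 16 * x.1 (siteL k) ^ 2 + 7 / 16 * x.1 (siteR k) ^ 2
    + 1 / 8 * (x.1 (siteL k) * x.1 (siteR k))

/-- `C` bounds the conditional second moments up to the quadratic form `nbrForm`. -/
def VarBound (V : ℝ → ℝ) (C : ℝ) : Prop :=
  0 ≤ C ∧ ∀ b c, ∫ u, u ^ 2 ∂rhoKernel V (b, c)
      ≤ 7 / 16 * b ^ 2 + 7 / 16 * c ^ 2 + 1 / 8 * (b * c) + C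

theorem Admissible.integral_sq_heatBath_le (hV : Admissible V) {C : ℝ} (hC : VarBound V C)
    (k : Fin (N - 1)) (x : Omega N) (i : Fin (N - 1)) :
    ∫ z, z.1 (site i) ^ 2 ∂heatBath V k x
      ≤ x.1 (site i) ^ 2 + if k = i then nbrForm x i + C - x.1 (site i) ^ 2 else 0 := by
  have := hV.isMarkovKernel_rhoKernel
  rw [hV.integral_heatBath k x ((measurable_coord _).pow_const 2)]
  simp only [setHeight_apply, site_injective.eq_iff]
  by_cases h : k = i
  · subst h
    have := hC.2 (x.1 (siteL k)) (x.1 (siteR k))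
    simp only [if_true, nbrForm]
    linarith
  · simp [h, Ne.symm h]

/-! ### Square-integrable measures on interfaces -/

/-- All heights are square integrable. -/
def SqIntegrable (μ : Measure (Omega N)) : Prop :=
  ∀ a, Integrable (fun x : Omega N => x.1 a ^ 2) μ

namespace SqIntegrable

variable {μ : Measure (Omega N)}

theorem mul (h : SqIntegrable μ) (a b : Fin (N + 1)) :
    Integrable (fun x : Omega N => x.1 a * x.1 b) μ := by
  refine ((h a).add (h b)).mono' (measurable_coord_mul a b).aestronglyMeasurable (Eventually.of_forall fun x => ?_)
  rw [Real.norm_eq_abs, abs_le, Pi.add_apply]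
  constructor <;> nlinarith [sq_nonneg (x.1 a + x.1 b), sq_nonneg (x.1 a - x.1 b)]

theorem coord [IsFiniteMeasure μ] (h : SqIntegrable μ) (a : Fin (N + 1)) :
    Integrable (fun x : Omega N => x.1 a) μ := by
  refine ((h a).add (integrable_const 1)).mono' (measurable_coord a).aestronglyMeasurable
    (Eventually.of_forall fun x => ?_)
  rw [Real.norm_eq_abs, abs_le, Pi.add_apply]
  constructor <;> nlinarith [sq_nonneg (x.1 a + 1), sq_nonneg (x.1 a - 1)]

theorem nbrMean [IsFiniteMeasure μ] (h : SqIntegrable μ) (k : Fin (N - 1)) :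
    Integrable (fun x : Omega N => nbrMean x k) μ :=
  ((h.coord (siteL k)).add (h.coord (siteR k))).div_const 2

theorem integral_nbrMean [IsFiniteMeasure μ] (h : SqIntegrable μ) (k : Fin (N - 1)) :
    ∫ x, GradPhi.nbrMean x k ∂μ = ((∫ x, x.1 (siteL k) ∂μ) + ∫ x, x.1 (siteR k) ∂μ) / 2 := by
  simp only [GradPhi.nbrMean]
  rw [integral_div, integral_add (h.coord _) (h.coord _)]

theorem nbrMean_mul (h : SqIntegrable μ) (k : Fin (N - 1)) (b : Fin (N + 1)) :
    Integrable (fun x : Omega N => GradPhi.nbrMean x k * x.1 b) μ :=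
  (((h.mul (siteL k) b).add (h.mul (siteR k) b)).div_const 2).congr
    (Eventually.of_forall fun x => by simp only [GradPhi.nbrMean, Pi.add_apply]; ring)

theorem integral_nbrMean_mul (h : SqIntegrable μ) (k : Fin (N - 1)) (b : Fin (N + 1)) :
    ∫ x, GradPhi.nbrMean x k * x.1 b ∂μ
      = ((∫ x, x.1 (siteL k) * x.1 b ∂μ) + ∫ x, x.1 (siteR k) * x.1 b ∂μ) / 2 := by
  rw [← integral_add (h.mul _ _) (h.mul _ _), ← integral_div]
  congr 1
  funext x
  simp only [GradPhi.nbrMean]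
  ring

theorem nbrForm (h : SqIntegrable μ) (k : Fin (N - 1)) :
    Integrable (fun x : Omega N => nbrForm x k) μ :=
  (((h (siteL k)).const_mul _).add ((h (siteR k)).const_mul _)).add
    ((h.mul (siteL k) (siteR k)).const_mul _)

theorem integral_nbrForm (h : SqIntegrable μ) (k : Fin (N - 1)) :
    ∫ x, GradPhi.nbrForm x k ∂μ = 7 / 16 * (∫ x, x.1 (siteL k) ^ 2 ∂μ)
      + 7 / 16 * (∫ x, x.1 (siteR k) ^ 2 ∂μ) + 1 / 8 * ∫ x, x.1 (siteL k) * x.1 (siteR k) ∂μ := by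
  have i1 := (h (siteL k)).const_mul (7 / 16)
  have i2 := (h (siteR k)).const_mul (7 / 16)
  have i3 := (h.mul (siteL k) (siteR k)).const_mul (1 / 8)
  simp only [GradPhi.nbrForm]
  rw [integral_add (by exact i1.add i2) i3, integral_add i1 i2, integral_const_mul,
    integral_const_mul, integral_const_mul]

end SqIntegrable

theorem integral_bind_kernel {α β : Type*} [MeasurableSpace α] [MeasurableSpace β]
    {μ : Measure α} {κ : Kernel α β} {φ : β → ℝ} (h : Integrable φ (μ.bind κ)) :
    ∫ z, φ z ∂μ.bind κ = ∫ y, ∫ z, φ z ∂κ y ∂μ := by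
  have e : μ.bind κ = (κ ∘ₖ Kernel.const Unit μ) () := by
    rw [Kernel.comp_apply, Kernel.const_apply]
  rw [e] at h ⊢
  rw [Kernel.integral_comp h, Kernel.const_apply]

/-! ### A step of the embedded chain -/

theorem Admissible.isFiniteKernel_updateSum (hV : Admissible V) : IsFiniteKernel (updateSum V N) := by
  have := fun k : Fin (N - 1) => hV.isMarkovKernel_heatBath k
  unfold updateSum
  exact Finset.sum_induction _ IsFiniteKernel (fun _ _ _ _ => inferInstance) inferInstance
    fun k _ => inferInstance

theorem updateSum_apply (x : Omega N) :
    updateSum V N x = ∑ k : Fin (N - 1), heatBath V k x := by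
  rw [updateSum, _root_.sum_apply]

theorem Admissible.integral_coord_updateSum (hV : Admissible V) (x : Omega N) (i : Fin (N - 1)) :
    ∫ z, z.1 (site i) ∂updateSum V N x
      = ((N - 1 : ℕ) : ℝ) * x.1 (site i) + (nbrMean x i - x.1 (site i)) := by
  have hM := fun k : Fin (N - 1) => hV.isMarkovKernel_heatBath k
  rw [updateSum_apply, integral_finsetSum_measure fun k _ =>
    SqIntegrable.coord (hV.integrable_sq_heatBath k x) _]
  simp only [hV.integral_coord_heatBath, Finset.sum_add_distrib]
  simp

theorem Admissible.integral_mul_updateSum (hV : Admissible V) (x : Omega N) {i j : Fin (N - 1)}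
    (hij : i ≠ j) :
    ∫ z, z.1 (site i) * z.1 (site j) ∂updateSum V N x
      = ((N - 1 : ℕ) : ℝ) * (x.1 (site i) * x.1 (site j))
        + (nbrMean x i - x.1 (site i)) * x.1 (site j)
        + (nbrMean x j - x.1 (site j)) * x.1 (site i) := by
  have hM := fun k : Fin (N - 1) => hV.isMarkovKernel_heatBath k
  rw [updateSum_apply, integral_finsetSum_measure fun k _ =>
    SqIntegrable.mul (hV.integrable_sq_heatBath k x) _ _]
  simp only [hV.integral_site_mul_site_heatBath _ x hij, Finset.sum_add_distrib]
  simp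

theorem Admissible.integrable_sq_updateSum (hV : Admissible V) (x : Omega N) (a : Fin (N + 1)) :
    Integrable (fun z : Omega N => z.1 a ^ 2) (updateSum V N x) := by
  rw [updateSum_apply, integrable_finsetSum_measure]
  exact fun k _ => hV.integrable_sq_heatBath k x a

theorem Admissible.integral_sq_updateSum_le (hV : Admissible V) {C : ℝ} (hC : VarBound V C)
    (x : Omega N) (i : Fin (N - 1)) :
    ∫ z, z.1 (site i) ^ 2 ∂updateSum V N x
      ≤ ((N - 1 : ℕ) : ℝ) * x.1 (site i) ^ 2 + (nbrForm x i + C - x.1 (site i) ^ 2) := by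
  rw [updateSum_apply, integral_finsetSum_measure fun k _ => hV.integrable_sq_heatBath k x _]
  refine (Finset.sum_le_sum fun k _ => hV.integral_sq_heatBath_le hC k x i).trans ?_
  rw [Finset.sum_add_distrib]
  simp

theorem coord_zero (x : Omega N) : x.1 0 = 0 := x.2.1

theorem coord_last (x : Omega N) : x.1 (Fin.last N) = 0 := x.2.2

theorem SqIntegrable.bind_updateSum (hV : Admissible V) {C : ℝ} (hC : VarBound V C)
    {μ : Measure (Omega N)} [IsFiniteMeasure μ] (h : SqIntegrable μ) :
    SqIntegrable (μ.bind (updateSum V N)) := by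
  have := hV.isFiniteKernel_updateSum (N := N)
  intro a
  rcases eq_zero_or_eq_last_or_eq_site a with rfl | rfl | ⟨i, rfl⟩
  · simp [coord_zero]
  · simp [coord_last]
  have hm := (measurable_coord (site i)).pow_const 2
  refine (Measure.integrable_comp_iff hm.aestronglyMeasurable).2
    ⟨Eventually.of_forall fun x => hV.integrable_sq_updateSum x _, ?_⟩
  refine (((h (site i)).const_mul ((N - 1 : ℕ) : ℝ)).add
    (((h.nbrForm i).add (integrable_const C)).sub (h (site i)))).mono' ?_
    (Eventually.of_forall fun x => ?_)
  · exact hm.norm.stronglyMeasurable.integral_kernel.aestronglyMeasurable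
  · rw [Real.norm_of_nonneg (integral_nonneg fun _ => norm_nonneg _)]
    simp only [norm_pow, Real.norm_eq_abs, sq_abs]
    exact hV.integral_sq_updateSum_le hC x i

/-! ### Evolution of the first two moments -/

/-- The matrix of second moments of the heights. -/
noncomputable def secondMoment (μ : Measure (Omega N)) (a b : Fin (N + 1)) : ℝ :=
  ∫ z, z.1 a * z.1 b ∂μ

theorem secondMoment_comm (μ : Measure (Omega N)) (a b : Fin (N + 1)) :
    secondMoment μ a b = secondMoment μ b a := by
  simp only [secondMoment, mul_comm]

theorem secondMoment_of_boundary (μ : Measure (Omega N)) {a b : Fin (N + 1)}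
    (h : a = 0 ∨ a = Fin.last N ∨ b = 0 ∨ b = Fin.last N) : secondMoment μ a b = 0 := by
  rcases h with rfl | rfl | rfl | rfl <;> simp [secondMoment, coord_zero, coord_last]

section Step

variable {μ : Measure (Omega N)} [IsFiniteMeasure μ]

theorem integral_coord_bind_updateSum (hV : Admissible V) {C : ℝ} (hC : VarBound V C)
    (h : SqIntegrable μ) (i : Fin (N - 1)) :
    ∫ z, z.1 (site i) ∂μ.bind (updateSum V N)
      = (((N - 1 : ℕ) : ℝ) - 1) * ∫ z, z.1 (site i) ∂μ
        + ((∫ z, z.1 (siteL i) ∂μ) + ∫ z, z.1 (siteR i) ∂μ) / 2 := by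
  have := hV.isFiniteKernel_updateSum (N := N)
  rw [integral_bind_kernel ((h.bind_updateSum hV hC).coord _)]
  simp only [hV.integral_coord_updateSum]
  rw [integral_add ((h.coord _).const_mul _) (by exact (h.nbrMean i).sub (h.coord _)),
    integral_sub (h.nbrMean i) (h.coord _), integral_const_mul, h.integral_nbrMean]
  ring

/-- An update moves one height only, so distinct sites involve just conditional means, even when
adjacent. The identity is exact and does not see V, which enters only on the diagonal. -/
theorem secondMoment_bind_updateSum (hV : Admissible V) {C : ℝ} (hC : VarBound V C)
    (h : SqIntegrable μ) {i j : Fin (N - 1)} (hij : i ≠ j) :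
    secondMoment (μ.bind (updateSum V N)) (site i) (site j)
      = (((N - 1 : ℕ) : ℝ) - 2) * secondMoment μ (site i) (site j)
        + (secondMoment μ (siteL i) (site j) + secondMoment μ (siteR i) (site j)) / 2
        + (secondMoment μ (siteL j) (site i) + secondMoment μ (siteR j) (site i)) / 2 := by
  have := hV.isFiniteKernel_updateSum (N := N)
  rw [secondMoment, integral_bind_kernel ((h.bind_updateSum hV hC).mul _ _)]
  simp only [hV.integral_mul_updateSum _ hij, sub_mul]
  have i1 := (h.mul (site i) (site j)).const_mul ((N - 1 : ℕ) : ℝ)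
  have i2 := (h.nbrMean_mul i (site j)).sub (h.mul (site i) (site j))
  have i3 := (h.nbrMean_mul j (site i)).sub (h.mul (site j) (site i))
  rw [integral_add (by exact i1.add i2) (by exact i3), integral_add i1 (by exact i2),
    integral_sub (h.nbrMean_mul _ _) (h.mul _ _), integral_sub (h.nbrMean_mul _ _) (h.mul _ _),
    integral_const_mul, h.integral_nbrMean_mul, h.integral_nbrMean_mul]
  have e := secondMoment_comm μ (site i) (site j)
  simp only [secondMoment] at e ⊢
  rw [e]
  ring

theorem secondMoment_self_bind_updateSum_le (hV : Admissible V) {C : ℝ} (hC : VarBound V C)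
    (h : SqIntegrable μ) (i : Fin (N - 1)) :
    secondMoment (μ.bind (updateSum V N)) (site i) (site i)
      ≤ (((N - 1 : ℕ) : ℝ) - 1) * secondMoment μ (site i) (site i)
        + (7 / 16 * secondMoment μ (siteL i) (siteL i)
          + 7 / 16 * secondMoment μ (siteR i) (siteR i)
          + 1 / 8 * secondMoment μ (siteL i) (siteR i)) + C * μ.real univ := by
  have := hV.isFiniteKernel_updateSum (N := N)
  simp only [secondMoment, ← pow_two]
  have hb := h.bind_updateSum hV hC (site i)
  rw [integral_bind_kernel hb]
  have i1 := (h (site i)).const_mul ((N - 1 : ℕ) : ℝ)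
  have i2 := (h.nbrForm i).add (integrable_const (μ := μ) C)
  have i3 := i2.sub (h (site i))
  calc ∫ y, ∫ z, z.1 (site i) ^ 2 ∂updateSum V N y ∂μ
      ≤ ∫ y, (((N - 1 : ℕ) : ℝ) * y.1 (site i) ^ 2
          + (nbrForm y i + C - y.1 (site i) ^ 2)) ∂μ := by
        refine integral_mono_of_nonneg
          (Eventually.of_forall fun y => integral_nonneg fun z => sq_nonneg _) (i1.add i3)
          (Eventually.of_forall fun y => hV.integral_sq_updateSum_le hC y i)
    _ = _ := by
        rw [integral_add i1 (by exact i3), integral_sub (by exact i2) (h _),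
          integral_add (h.nbrForm i) (integrable_const C), integral_const_mul,
          h.integral_nbrForm, integral_const, smul_eq_mul]
        ring

end Step

/-! ### Powers of the update kernel: mass, integrability and means -/

theorem updatePow_succ_apply (n : ℕ) (x : Omega N) :
    updatePow V N (n + 1) x = (updatePow V N n x).bind (updateSum V N) := by
  rw [updatePow, Kernel.comp_apply]

theorem Admissible.updateSum_univ (hV : Admissible V) (x : Omega N) :
    updateSum V N x univ = ((N - 1 : ℕ) : ENNReal) := by
  have hM := fun k : Fin (N - 1) => hV.isMarkovKernel_heatBath k
  rw [updateSum_apply, Measure.finsetSum_apply]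
  simp

theorem Admissible.updatePow_univ (hV : Admissible V) (n : ℕ) (x : Omega N) :
    updatePow V N n x univ = ((N - 1 : ℕ) : ENNReal) ^ n := by
  induction n with
  | zero => simp [updatePow, Kernel.id_apply]
  | succ n ih =>
    rw [updatePow_succ_apply, Measure.bind_apply MeasurableSet.univ (Kernel.aemeasurable _)]
    simp only [hV.updateSum_univ]
    rw [lintegral_const, ih, pow_succ']

theorem Admissible.isFiniteMeasure_updatePow (hV : Admissible V) (n : ℕ) (x : Omega N) :
    IsFiniteMeasure (updatePow V N n x) :=
  ⟨by rw [hV.updatePow_univ]; exact ENNReal.pow_lt_top (ENNReal.natCast_lt_top _)⟩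

theorem Admissible.updatePow_real_univ (hV : Admissible V) (n : ℕ) (x : Omega N) :
    (updatePow V N n x).real univ = ((N - 1 : ℕ) : ℝ) ^ n := by
  rw [Measure.real, hV.updatePow_univ, ENNReal.toReal_pow, ENNReal.toReal_natCast]

theorem Admissible.sqIntegrable_updatePow (hV : Admissible V) {C : ℝ} (hC : VarBound V C) (n : ℕ)
    (x : Omega N) : SqIntegrable (updatePow V N n x) := by
  have := fun n => hV.isFiniteMeasure_updatePow n x
  induction n with
  | zero =>
    intro a
    rw [updatePow, Kernel.id_apply]
    exact integrable_dirac' ((measurable_coord a).pow_const 2).stronglyMeasurable (by simp)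
  | succ n ih =>
    rw [updatePow_succ_apply]
    exact ih.bind_updateSum hV hC

theorem Admissible.integral_coord_updatePow (hV : Admissible V) {C : ℝ} (hC : VarBound V C)
    {x : Omega N} {l : ℝ} (hx : ∀ k, nbrMean x k = (1 - l) * x.1 (site k)) (n : ℕ)
    (a : Fin (N + 1)) :
    ∫ z, z.1 a ∂updatePow V N n x = (((N - 1 : ℕ) : ℝ) - l) ^ n * x.1 a := by
  have := fun n => hV.isFiniteMeasure_updatePow n x
  induction n generalizing a with
  | zero =>
    rw [updatePow, Kernel.id_apply, integral_dirac' _ _ (measurable_coord a).stronglyMeasurable]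
    simp
  | succ n ih =>
    rcases eq_zero_or_eq_last_or_eq_site a with rfl | rfl | ⟨i, rfl⟩
    · simp [coord_zero]
    · simp [coord_last]
    rw [updatePow_succ_apply,
      integral_coord_bind_updateSum hV hC (hV.sqIntegrable_updatePow hC n x), ih, ih, ih]
    have := hx i
    rw [nbrMean] at this
    linear_combination (((N - 1 : ℕ) : ℝ) - l) ^ n * this

/-! ### The comparison matrix -/

/-- The covariance matrix of the discrete Brownian bridge. -/
noncomputable def bridge (N : ℕ) (a b : Fin (N + 1)) : ℝ :=
  min (a.1 : ℝ) b.1 * (N - max (a.1 : ℝ) b.1) / N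

theorem bridge_nonneg (a b : Fin (N + 1)) : 0 ≤ bridge N a b := by
  have h : max (a.1 : ℝ) b.1 ≤ N := max_le (by exact_mod_cast a.is_le) (by exact_mod_cast b.is_le)
  exact div_nonneg (mul_nonneg (by positivity) (sub_nonneg.2 h)) (by positivity)

theorem bridge_le (a b : Fin (N + 1)) : bridge N a b ≤ N := by
  have h : max (a.1 : ℝ) b.1 ≤ N := max_le (by exact_mod_cast a.is_le) (by exact_mod_cast b.is_le)
  have h0 : (0 : ℝ) ≤ max (a.1 : ℝ) b.1 := by positivity
  have h1 : min (a.1 : ℝ) b.1 ≤ N := min_le_max.trans h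
  refine div_le_of_le_mul₀ (by positivity) (by positivity) ?_
  exact mul_le_mul h1 (by linarith) (sub_nonneg.2 h) (by positivity)

theorem bridge_comm (a b : Fin (N + 1)) : bridge N a b = bridge N b a := by
  simp only [bridge, min_comm, max_comm]

/-- In each variable the bridge covariance is piecewise linear, with its only kink on the diagonal.
-/
theorem bridge_harmonic {k : Fin (N - 1)} {b : Fin (N + 1)} (hb : b ≠ site k) :
    (bridge N (siteL k) b + bridge N (siteR k) b) / 2 = bridge N (site k) b := by
  have hne : b.1 ≠ k.1 + 1 := fun h => hb (Fin.ext h)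
  simp only [bridge, siteL, siteR, site]
  push_cast
  rcases lt_or_gt_of_ne hne with h | h
  · have h' : (b.1 : ℝ) ≤ k.1 := by exact_mod_cast Nat.lt_succ_iff.1 h
    rw [min_eq_right h', max_eq_left h', min_eq_right (by linarith), max_eq_left (by linarith),
      min_eq_right (by linarith), max_eq_left (by linarith)]
    ring
  · have h' : (k.1 : ℝ) + 2 ≤ b.1 := by exact_mod_cast h
    rw [min_eq_left (by linarith), max_eq_right (by linarith), min_eq_left (by linarith),
      max_eq_right (by linarith), min_eq_left (by linarith), max_eq_right (by linarith)]
    ring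

/-- The gap is in fact 1/8 + 3/(4N). Its part of order one comes from the weight 1/8 on the
off-diagonal entry, which lies 1 - 1/N below the diagonal one. -/
theorem bridge_diag (k : Fin (N - 1)) :
    7 / 16 * bridge N (siteL k) (siteL k) + 7 / 16 * bridge N (siteR k) (siteR k)
      + 1 / 8 * bridge N (siteL k) (siteR k) ≤ bridge N (site k) (site k) - 1 / 8 := by
  have hN : (0 : ℝ) < N := by
    have := k.2
    exact_mod_cast (by omega : 0 < N)
  simp only [bridge, siteL, siteR, site]
  push_cast
  rw [min_self, max_self, min_self, max_self, min_self, max_self, min_eq_left (by linarith),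
    max_eq_right (by linarith), ← sub_nonneg]
  have : (k.1 + 1 : ℝ) * (N - (k.1 + 1)) / N - 1 / 8 - (7 / 16 * (k.1 * (N - k.1) / N)
      + 7 / 16 * ((k.1 + 2) * (N - (k.1 + 2)) / N) + 1 / 8 * (k.1 * (N - (k.1 + 2)) / N))
      = 3 / 4 / N := by
    field_simp
    ring
  rw [this]
  positivity

/-! ### Comparison for the chain started from an eigenfunction profile -/

/-- Off the diagonal, x_a x_b is an eigenvector for N - 1 - 2l and the bridge is harmonic, so the
bound propagates. On the diagonal the product leaves an error at most D and the update adds at most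
C; the factor 8 lets the drop 1/8 of the bridge pay for both. The induction needs nonnegative
coefficients: N - 2 on the diagonal, N - 3 off it, where two distinct interior sites exist. -/
theorem Admissible.secondMoment_updatePow_le (hV : Admissible V) {C : ℝ} (hC : VarBound V C)
    {x : Omega N} {l D : ℝ} (hl0 : 0 ≤ l) (hl1 : l ≤ 1) (hD : 0 ≤ D)
    (hx : ∀ k, nbrMean x k = (1 - l) * x.1 (site k))
    (hxD : ∀ k, (l * x.1 (site k)) ^ 2 + 3 / 16 * (x.1 (siteR k) - x.1 (siteL k)) ^ 2 ≤ D)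
    (n : ℕ) (a b : Fin (N + 1)) :
    secondMoment (updatePow V N n x) a b ≤ (((N - 1 : ℕ) : ℝ) - 2 * l) ^ n * (x.1 a * x.1 b)
      + 8 * (D + C) * ((N - 1 : ℕ) : ℝ) ^ n * bridge N a b := by
  have hfin := fun n => hV.isFiniteMeasure_updatePow n x
  have hK : 0 ≤ 8 * (D + C) := by linarith [hC.1]
  set K := 8 * (D + C) with hKdef
  induction n generalizing a b with
  | zero =>
    rw [secondMoment, updatePow, Kernel.id_apply, integral_dirac' _ _
      (measurable_coord_mul a b).stronglyMeasurable]
    have := mul_nonneg hK (bridge_nonneg a b)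
    simp only [pow_zero]
    linarith
  | succ n ih =>
    have hbd : ∀ a b : Fin (N + 1), (a = 0 ∨ a = Fin.last N ∨ b = 0 ∨ b = Fin.last N) →
        secondMoment (updatePow V N (n + 1) x) a b
          ≤ (((N - 1 : ℕ) : ℝ) - 2 * l) ^ (n + 1) * (x.1 a * x.1 b)
            + K * ((N - 1 : ℕ) : ℝ) ^ (n + 1) * bridge N a b := fun a b h => by
      rw [secondMoment_of_boundary _ h]
      have h0 : x.1 a * x.1 b = 0 := by
        rcases h with rfl | rfl | rfl | rfl <;> simp [coord_zero, coord_last]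
      rw [h0, mul_zero, zero_add]
      have := bridge_nonneg a b
      positivity
    rcases eq_zero_or_eq_last_or_eq_site a with ha | ha | ⟨i, rfl⟩
    · exact hbd _ _ (Or.inl ha)
    · exact hbd _ _ (Or.inr (Or.inl ha))
    rcases eq_zero_or_eq_last_or_eq_site b with hb | hb | ⟨j, rfl⟩
    · exact hbd _ _ (Or.inr (Or.inr (Or.inl hb)))
    · exact hbd _ _ (Or.inr (Or.inr (Or.inr hb)))
    have hS := hV.sqIntegrable_updatePow hC n x
    rw [updatePow_succ_apply]
    by_cases hij : i = j
    · subst hij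
      have hM : (1 : ℝ) ≤ ((N - 1 : ℕ) : ℝ) := by
        have := i.2
        exact_mod_cast (by omega : 1 ≤ N - 1)
      have h1 := secondMoment_self_bind_updateSum_le hV hC hS i
      rw [hV.updatePow_real_univ] at h1
      have h2 := mul_le_mul_of_nonneg_left (ih (site i) (site i)) (sub_nonneg.2 hM)
      have h3 := ih (siteL i) (siteL i)
      have h4 := ih (siteR i) (siteR i)
      have h5 := ih (siteL i) (siteR i)
      -- The base may be negative (it is -1 for N = 2, l = 1), but its absolute value is at most N -
      -- 1 because l ≤ 1 ≤ N - 1.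
      have hq : (((N - 1 : ℕ) : ℝ) - 2 * l) ^ n ≤ ((N - 1 : ℕ) : ℝ) ^ n := by
        refine (le_abs_self _).trans ?_
        rw [abs_pow]
        exact pow_le_pow_left₀ (abs_nonneg _) (abs_le.2 ⟨by linarith, by linarith⟩) n
      have hb := bridge_diag i
      have hxi := hx i
      have hxDi := hxD i
      rw [nbrMean] at hxi
      set q := (((N - 1 : ℕ) : ℝ) - 2 * l) ^ n
      set M := ((N - 1 : ℕ) : ℝ)
      have hP : (0 : ℝ) ≤ M ^ n := by positivity
      -- The squared neighbour mean is (1-l)² x_i² = (1-2l) x_i² + (l x_i)²; the last term joins the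
      -- squared gradient in the error.
      have e : 7 / 16 * (x.1 (siteL i) * x.1 (siteL i)) + 7 / 16 * (x.1 (siteR i) * x.1 (siteR i))
          + 1 / 8 * (x.1 (siteL i) * x.1 (siteR i))
          = (1 - 2 * l) * (x.1 (site i) * x.1 (site i)) + ((l * x.1 (site i)) ^ 2
            + 3 / 16 * (x.1 (siteR i) - x.1 (siteL i)) ^ 2) := by
        linear_combination ((x.1 (siteL i) + x.1 (siteR i)) / 2 + (1 - l) * x.1 (site i)) * hxi
      set E := (l * x.1 (site i)) ^ 2 + 3 / 16 * (x.1 (siteR i) - x.1 (siteL i)) ^ 2 with hE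
      have hE0 : 0 ≤ E := by positivity
      have h6 : q * E ≤ M ^ n * D :=
        (mul_le_mul_of_nonneg_right hq hE0).trans (mul_le_mul_of_nonneg_left hxDi hP)
      have h7 := mul_le_mul_of_nonneg_left hb (mul_nonneg hK hP)
      have e2 : K * M ^ n * (1 / 8) = M ^ n * D + C * M ^ n := by rw [hKdef]; ring
      rw [pow_succ, pow_succ]
      linear_combination h1 + h2 + 7 / 16 * h3 + 7 / 16 * h4 + 1 / 8 * h5 + h6 + h7 + q * e - e2
    · have hM : (2 : ℝ) ≤ ((N - 1 : ℕ) : ℝ) := by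
        have h1 := i.2
        have h2 := j.2
        have h3 : i.1 ≠ j.1 := fun h => hij (Fin.ext h)
        exact_mod_cast (by omega : 2 ≤ N - 1)
      rw [secondMoment_bind_updateSum hV hC hS hij]
      have h2 := mul_le_mul_of_nonneg_left (ih (site i) (site j)) (sub_nonneg.2 hM)
      have h3 := ih (siteL i) (site j)
      have h4 := ih (siteR i) (site j)
      have h5 := ih (siteL j) (site i)
      have h6 := ih (siteR j) (site i)
      have b1 := bridge_harmonic fun h : site j = site i => hij (site_injective h).symm
      have b2 := bridge_harmonic fun h : site i = site j => hij (site_injective h)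
      rw [bridge_comm (site j) (site i)] at b2
      have x1 := hx i
      have x2 := hx j
      rw [nbrMean] at x1 x2
      set q := (((N - 1 : ℕ) : ℝ) - 2 * l) ^ n
      set M := ((N - 1 : ℕ) : ℝ)
      rw [pow_succ, pow_succ]
      linear_combination h2 + h3 / 2 + h4 / 2 + h5 / 2 + h6 / 2 + K * M ^ n * b1 + K * M ^ n * b2
        + q * x.1 (site j) * x1 + q * x.1 (site i) * x2

/-! ### The law of the continuous-time chain -/

/-- Poissonisation turns a growth factor r per update into e^{(r-M)t}. With M = N - 1, the values r
= N - 1, N - 1 - l and N - 1 - 2l give 1, e^{-lt} and e^{-2lt}. -/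
theorem hasSum_poisson_mul_pow (M t r : ℝ) :
    HasSum (fun n : ℕ => Real.exp (-M * t) * (t ^ n / (n.factorial : ℝ)) * r ^ n)
      (Real.exp ((r - M) * t)) := by
  have h := (NormedSpace.expSeries_div_hasSum_exp (t * r)).mul_left (Real.exp (-M * t))
  rw [← Real.exp_eq_exp_ℝ, ← Real.exp_add] at h
  convert! h using 1
  · funext n
    rw [mul_pow]
    ring
  · ring_nf

theorem poisson_nonneg (M : ℝ) {t : ℝ} (ht : 0 ≤ t) (n : ℕ) :
    0 ≤ Real.exp (-M * t) * (t ^ n / (n.factorial : ℝ)) := by positivity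

theorem Admissible.isProbabilityMeasure_law (hV : Admissible V) (x : Omega N) {t : ℝ}
    (ht : 0 ≤ t) : IsProbabilityMeasure (law V x t) := by
  constructor
  rw [law, Measure.sum_apply _ MeasurableSet.univ]
  simp only [Measure.smul_apply, hV.updatePow_univ, smul_eq_mul]
  have h := hasSum_poisson_mul_pow ((N - 1 : ℕ) : ℝ) t ((N - 1 : ℕ) : ℝ)
  have e : ∀ n : ℕ, ENNReal.ofReal (Real.exp (-((N - 1 : ℕ) : ℝ) * t) * (t ^ n / (n.factorial : ℝ)))
      * ((N - 1 : ℕ) : ENNReal) ^ n = ENNReal.ofReal (Real.exp (-((N - 1 : ℕ) : ℝ) * t)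
        * (t ^ n / (n.factorial : ℝ)) * ((N - 1 : ℕ) : ℝ) ^ n) := fun n => by
    rw [ENNReal.ofReal_mul (poisson_nonneg _ ht n), ENNReal.ofReal_pow (by positivity),
      ENNReal.ofReal_natCast]
  simp only [e]
  rw [← ENNReal.ofReal_tsum_of_nonneg (fun n => mul_nonneg (poisson_nonneg _ ht n)
    (by positivity)) h.summable, h.tsum_eq]
  simp

theorem hasSum_integral_law {x : Omega N} {t : ℝ} (ht : 0 ≤ t) {φ : Omega N → ℝ}
    (h : Integrable φ (law V x t)) :
    HasSum (fun n : ℕ => Real.exp (-((N - 1 : ℕ) : ℝ) * t) * (t ^ n / (n.factorial : ℝ))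
      * ∫ z, φ z ∂updatePow V N n x) (∫ z, φ z ∂law V x t) := by
  have := hasSum_integral_measure h
  simp only [integral_smul_measure, ENNReal.toReal_ofReal (poisson_nonneg _ ht _),
    smul_eq_mul] at this
  exact this

section Profile

variable {x : Omega N} {C l D t : ℝ}

theorem Admissible.sqIntegrable_law (hV : Admissible V) (hC : VarBound V C)
    (hl0 : 0 ≤ l) (hl1 : l ≤ 1) (hD : 0 ≤ D)
    (hx : ∀ k, nbrMean x k = (1 - l) * x.1 (site k))
    (hxD : ∀ k, (l * x.1 (site k)) ^ 2 + 3 / 16 * (x.1 (siteR k) - x.1 (siteL k)) ^ 2 ≤ D)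
    (ht : 0 ≤ t) : SqIntegrable (law V x t) := by
  intro a
  refine integrable_sum_measure
    (fun n => (hV.sqIntegrable_updatePow hC n x a).smul_measure ENNReal.ofReal_ne_top) ?_
  simp only [integral_smul_measure, ENNReal.toReal_ofReal (poisson_nonneg _ ht _), smul_eq_mul,
    norm_pow, Real.norm_eq_abs, sq_abs]
  have hs := ((hasSum_poisson_mul_pow ((N - 1 : ℕ) : ℝ) t
    (((N - 1 : ℕ) : ℝ) - 2 * l)).summable.mul_right (x.1 a * x.1 a)).add
    ((hasSum_poisson_mul_pow ((N - 1 : ℕ) : ℝ) t ((N - 1 : ℕ) : ℝ)).summable.mul_right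
      (8 * (D + C) * bridge N a a))
  refine Summable.of_nonneg_of_le (fun n => mul_nonneg (poisson_nonneg _ ht n)
    (integral_nonneg fun z => sq_nonneg _)) (fun n => ?_) hs
  have h := mul_le_mul_of_nonneg_left
    (hV.secondMoment_updatePow_le hC hl0 hl1 hD hx hxD n a a)
    (poisson_nonneg ((N - 1 : ℕ) : ℝ) ht n)
  simp only [secondMoment, ← pow_two] at h
  refine h.trans (le_of_eq ?_)
  ring

theorem Admissible.integral_coord_law (hV : Admissible V) (hC : VarBound V C)
    (hl0 : 0 ≤ l) (hl1 : l ≤ 1) (hD : 0 ≤ D)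
    (hx : ∀ k, nbrMean x k = (1 - l) * x.1 (site k))
    (hxD : ∀ k, (l * x.1 (site k)) ^ 2 + 3 / 16 * (x.1 (siteR k) - x.1 (siteL k)) ^ 2 ≤ D)
    (ht : 0 ≤ t) (a : Fin (N + 1)) :
    ∫ z, z.1 a ∂law V x t = Real.exp (-l * t) * x.1 a := by
  have := hV.isProbabilityMeasure_law x ht
  have h := hasSum_integral_law ht
    ((hV.sqIntegrable_law hC hl0 hl1 hD hx hxD ht).coord a)
  simp only [hV.integral_coord_updatePow hC hx, ← mul_assoc] at h
  have h' := (hasSum_poisson_mul_pow ((N - 1 : ℕ) : ℝ) t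
    (((N - 1 : ℕ) : ℝ) - l)).mul_right (x.1 a)
  rw [h.unique h']
  ring_nf

theorem Admissible.secondMoment_law_le (hV : Admissible V) (hC : VarBound V C)
    (hl0 : 0 ≤ l) (hl1 : l ≤ 1) (hD : 0 ≤ D)
    (hx : ∀ k, nbrMean x k = (1 - l) * x.1 (site k))
    (hxD : ∀ k, (l * x.1 (site k)) ^ 2 + 3 / 16 * (x.1 (siteR k) - x.1 (siteL k)) ^ 2 ≤ D)
    (ht : 0 ≤ t) (a b : Fin (N + 1)) :
    secondMoment (law V x t) a b ≤ Real.exp (-2 * l * t) * (x.1 a * x.1 b)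
      + 8 * (D + C) * bridge N a b := by
  have h := hasSum_integral_law ht
    ((hV.sqIntegrable_law hC hl0 hl1 hD hx hxD ht).mul a b)
  have h' := ((hasSum_poisson_mul_pow ((N - 1 : ℕ) : ℝ) t
    (((N - 1 : ℕ) : ℝ) - 2 * l)).mul_right (x.1 a * x.1 b)).add
    ((hasSum_poisson_mul_pow ((N - 1 : ℕ) : ℝ) t ((N - 1 : ℕ) : ℝ)).mul_right
      (8 * (D + C) * bridge N a b))
  have hle := hasSum_le (fun n => ?_) h h'
  · refine hle.trans (le_of_eq ?_)
    rw [sub_self, zero_mul, Real.exp_zero, one_mul]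
    ring_nf
  · have h := mul_le_mul_of_nonneg_left
      (hV.secondMoment_updatePow_le hC hl0 hl1 hD hx hxD n a b)
      (poisson_nonneg ((N - 1 : ℕ) : ℝ) ht n)
    refine h.trans (le_of_eq ?_)
    ring

end Profile

/-! ### A second moment lower bound for the total variation distance -/

section TotalVariation

variable {α : Type*} [MeasurableSpace α] {P Q : Measure α}

/-- A real supremum over an unbounded set defaults to 0, so boundedness is needed before any lower
bound. -/
theorem bddAbove_tvDist [IsProbabilityMeasure P] :
    BddAbove (range fun B : {B : Set α // MeasurableSet B} => P.real B - Q.real B) :=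
  ⟨1, by
    rintro _ ⟨B, rfl⟩
    have h1 : P.real B.1 ≤ 1 := measureReal_le_one
    have h2 : 0 ≤ Q.real B.1 := measureReal_nonneg
    linarith⟩

theorem sub_le_tvDist [IsProbabilityMeasure P] {B : Set α} (hB : MeasurableSet B) :
    P.real B - Q.real B ≤ tvDist P Q :=
  le_ciSup (f := fun B : {B : Set α // MeasurableSet B} => P.real B - Q.real B)
    bddAbove_tvDist ⟨B, hB⟩

theorem tvDist_le_one [IsProbabilityMeasure P] : tvDist P Q ≤ 1 := by
  have : Nonempty {B : Set α // MeasurableSet B} := ⟨⟨∅, MeasurableSet.empty⟩⟩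
  refine ciSup_le fun B => ?_
  have h1 : P.real B.1 ≤ 1 := measureReal_le_one
  have h2 : 0 ≤ Q.real B.1 := measureReal_nonneg
  linarith

/-- The function a g²/2 + 1/(2a) ∓ g is nonnegative. Integrate it with the minus sign over the Hahn
set s where P dominates Q, and with the plus sign over its complement, where Q dominates P. The
constants contribute (P(s) - Q(s))/a, and the g² terms of the wrong sign are dropped. -/
theorem exists_integral_sub_le [IsProbabilityMeasure P] [IsProbabilityMeasure Q] {g : α → ℝ}
    (hP : Integrable g P) (hP2 : Integrable (fun x => g x ^ 2) P)
    (hQ : Integrable g Q) (hQ2 : Integrable (fun x => g x ^ 2) Q) {a : ℝ} (ha : 0 < a) :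
    ∫ x, g x ∂P - ∫ x, g x ∂Q
      ≤ a / 2 * (∫ x, g x ^ 2 ∂P + ∫ x, g x ^ 2 ∂Q) + 1 / a * tvDist P Q := by
  obtain ⟨s, hs, h1, h2⟩ := hahn_decomposition P Q
  have r1 : Q.restrict s ≤ P.restrict s := Measure.le_iff.2 fun t ht => by
    rw [Measure.restrict_apply ht, Measure.restrict_apply ht]
    exact h1 _ (ht.inter hs) inter_subset_right
  have r2 : P.restrict sᶜ ≤ Q.restrict sᶜ := Measure.le_iff.2 fun t ht => by
    rw [Measure.restrict_apply ht, Measure.restrict_apply ht]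
    exact h2 _ (ht.inter hs.compl) inter_subset_right
  have amgm : ∀ y : ℝ, 0 ≤ a / 2 * y ^ 2 + 1 / (2 * a) - y := fun y => by
    have : a / 2 * y ^ 2 + 1 / (2 * a) - y = (a * y - 1) ^ 2 / (2 * a) := by
      field_simp
      ring
    rw [this]
    positivity
  have iφ : ∀ (c : ℝ) (μ : Measure α) [IsProbabilityMeasure μ], Integrable g μ →
      Integrable (fun x => g x ^ 2) μ → ∀ u : Set α,
      IntegrableOn (fun x => a / 2 * g x ^ 2 + 1 / (2 * a) - c * g x) u μ ∧
      ∫ x in u, (a / 2 * g x ^ 2 + 1 / (2 * a) - c * g x) ∂μ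
        = a / 2 * ∫ x in u, g x ^ 2 ∂μ + 1 / (2 * a) * μ.real u - c * ∫ x in u, g x ∂μ := by
    intro c μ _ hg hg2 u
    have i1 := (hg2.const_mul (a / 2)).integrableOn (s := u)
    have i2 : IntegrableOn (fun _ => 1 / (2 * a)) u μ := integrable_const _
    have i3 := (hg.const_mul c).integrableOn (s := u)
    refine ⟨(i1.add i2).sub i3, ?_⟩
    rw [integral_sub (by exact i1.add i2) i3, integral_add i1 i2, integral_const_mul,
      integral_const_mul, setIntegral_const, smul_eq_mul]
    ring
  obtain ⟨iP, eP⟩ := iφ 1 P hP hP2 s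
  obtain ⟨-, eQ⟩ := iφ 1 Q hQ hQ2 s
  obtain ⟨-, eP'⟩ := iφ (-1) P hP hP2 sᶜ
  obtain ⟨iQ', eQ'⟩ := iφ (-1) Q hQ hQ2 sᶜ
  have k1 := integral_mono_measure r1 (Eventually.of_forall fun x => by
    simpa using amgm (g x)) iP
  have k2 := integral_mono_measure r2 (Eventually.of_forall fun x => by
    simpa using amgm (-g x)) iQ'
  rw [eP, eQ] at k1
  rw [eP', eQ'] at k2
  have sP := integral_add_compl hs hP
  have sQ := integral_add_compl hs hQ
  have sP2 := integral_add_compl hs hP2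
  have sQ2 := integral_add_compl hs hQ2
  have n1 : 0 ≤ ∫ x in sᶜ, g x ^ 2 ∂P := integral_nonneg fun x => sq_nonneg _
  have n2 : 0 ≤ ∫ x in s, g x ^ 2 ∂Q := integral_nonneg fun x => sq_nonneg _
  have cP : P.real sᶜ = 1 - P.real s := probReal_compl_eq_one_sub hs
  have cQ : Q.real sᶜ = 1 - Q.real s := probReal_compl_eq_one_sub hs
  have tv := mul_le_mul_of_nonneg_left (sub_le_tvDist (P := P) (Q := Q) hs)
    (one_div_pos.2 ha).le
  have e2 : 1 / (2 * a) = 1 / a / 2 := by ring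
  rw [cP, cQ, e2] at k2
  rw [e2] at k1
  have n1' := mul_nonneg ha.le n1
  have n2' := mul_nonneg ha.le n2
  rw [← sP, ← sQ, ← sP2, ← sQ2]
  linear_combination k1 + k2 + tv + n1' + n2'

/-- Centring f at m/2, midway between the two means, bounds both second moments by S + m²/4. -/
theorem le_tvDist_of_moments [IsProbabilityMeasure P] [IsProbabilityMeasure Q] {f : α → ℝ}
    (hP : Integrable f P) (hP2 : Integrable (fun x => f x ^ 2) P)
    (hQ : Integrable f Q) (hQ2 : Integrable (fun x => f x ^ 2) Q) {m S : ℝ} (hm : 0 < m)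
    (hS : 0 < S) (eP : ∫ x, f x ∂P = m) (eQ : ∫ x, f x ∂Q = 0)
    (bP : ∫ x, f x ^ 2 ∂P ≤ m ^ 2 + S) (bQ : ∫ x, f x ^ 2 ∂Q ≤ S) :
    1 - 1 / (1 + m ^ 2 / (4 * S)) ≤ tvDist P Q := by
  have i1 : ∀ (μ : Measure α) [IsProbabilityMeasure μ], Integrable f μ →
      Integrable (fun x => f x ^ 2) μ → Integrable (fun x => f x - m / 2) μ ∧
      Integrable (fun x => (f x - m / 2) ^ 2) μ ∧ ∫ x, (f x - m / 2) ∂μ = ∫ x, f x ∂μ - m / 2 ∧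
      ∫ x, (f x - m / 2) ^ 2 ∂μ = ∫ x, f x ^ 2 ∂μ - m * ∫ x, f x ∂μ + m ^ 2 / 4 := by
    intro μ _ h h2
    have e : ∀ x, (f x - m / 2) ^ 2 = f x ^ 2 - m * f x + m ^ 2 / 4 := fun x => by ring
    have i := h2.sub (h.const_mul m)
    simp only [e]
    refine ⟨h.sub (integrable_const _), i.add (integrable_const _), ?_, ?_⟩
    · rw [integral_sub h (integrable_const _), integral_const]
      simp
    · rw [integral_add (by exact i) (integrable_const _), integral_sub h2 (h.const_mul m),
        integral_const_mul, integral_const]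
      simp
  obtain ⟨a1, a2, a3, a4⟩ := i1 P hP hP2
  obtain ⟨b1, b2, b3, b4⟩ := i1 Q hQ hQ2
  have hW : 0 < 2 * S + m ^ 2 / 2 := by positivity
  -- With W = 2S + m²/2 the total second moment bound, a = m/W makes the quadratic term m/2, half of
  -- the difference of means; hence the distance is at least m²/(2W).
  have h := exists_integral_sub_le a1 a2 b1 b2 (div_pos hm hW)
  rw [a3, a4, b3, b4, eP, eQ] at h
  have h' : m ≤ m / (2 * S + m ^ 2 / 2) / 2 * (2 * S + m ^ 2 / 2)
      + 1 / (m / (2 * S + m ^ 2 / 2)) * tvDist P Q := by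
    refine le_trans (by linarith) (h.trans (add_le_add
      (mul_le_mul_of_nonneg_left ?_ (by positivity)) le_rfl))
    linarith
  have e1 : m / (2 * S + m ^ 2 / 2) / 2 * (2 * S + m ^ 2 / 2) = m / 2 := by field_simp
  rw [e1, one_div_div, div_mul_eq_mul_div, ← sub_le_iff_le_add', le_div_iff₀ hm] at h'
  have e2 : 1 - 1 / (1 + m ^ 2 / (4 * S)) = m ^ 2 / (4 * S + m ^ 2) := by
    field_simp
    ring
  rw [e2, div_le_iff₀ (by positivity)]
  linarith

end TotalVariation

/-! ### The equilibrium measure -/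

theorem ofInterior_site (y : Fin (N - 1) → ℝ) (k : Fin (N - 1)) :
    (ofInterior y).1 (site k) = y k := by
  have : 1 ≤ k.1 + 1 ∧ k.1 + 1 < N := ⟨by omega, by omega⟩
  simp only [ofInterior, site]
  rw [dif_pos this]
  rfl

theorem Omega.ext_site {x z : Omega N} (h : ∀ k, x.1 (site k) = z.1 (site k)) : x = z := by
  refine Subtype.ext (funext fun a => ?_)
  rcases eq_zero_or_eq_last_or_eq_site a with rfl | rfl | ⟨i, rfl⟩
  · rw [coord_zero, coord_zero]
  · rw [coord_last, coord_last]
  · exact h i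

theorem setHeight_ofInterior (y : Fin (N - 1) → ℝ) (k : Fin (N - 1)) (u : ℝ) :
    setHeight (ofInterior y) k u = ofInterior (Function.update y k u) := by
  refine Omega.ext_site fun j => ?_
  rw [setHeight_apply, ofInterior_site, ofInterior_site, Function.update_apply]
  simp only [site_injective.eq_iff]

theorem setHeight_setHeight (x : Omega N) (k : Fin (N - 1)) (u v : ℝ) :
    setHeight (setHeight x k u) k v = setHeight x k v := by
  refine Omega.ext_site fun j => ?_
  simp only [setHeight_apply]
  split_ifs <;> rfl

theorem siteL_ne_site (k : Fin (N - 1)) : siteL k ≠ site k := by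
  simp [siteL, site, Fin.ext_iff]

theorem siteR_ne_site (k : Fin (N - 1)) : siteR k ≠ site k := by
  simp [siteR, site, Fin.ext_iff]

theorem setHeight_siteL (x : Omega N) (k : Fin (N - 1)) (u : ℝ) :
    (setHeight x k u).1 (siteL k) = x.1 (siteL k) := by
  rw [setHeight_apply, if_neg (siteL_ne_site k)]

theorem setHeight_siteR (x : Omega N) (k : Fin (N - 1)) (u : ℝ) :
    (setHeight x k u).1 (siteR k) = x.1 (siteR k) := by
  rw [setHeight_apply, if_neg (siteR_ne_site k)]

theorem measurable_ofInterior : Measurable (ofInterior : (Fin (N - 1) → ℝ) → Omega N) := by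
  refine Measurable.subtype_mk (measurable_pi_iff.2 fun a => ?_)
  split_ifs
  · exact measurable_pi_apply _
  · exact measurable_const

theorem Admissible.measurable_hamiltonian (hV : Admissible V) :
    Measurable (hamiltonian V : Omega N → ℝ) :=
  Finset.measurable_sum _ fun i _ => hV.continuous.measurable.comp
    ((measurable_coord i.succ).sub (measurable_coord i.castSucc))

theorem exists_hamiltonian_setHeight (V : ℝ → ℝ) (x : Omega N) (k : Fin (N - 1)) :
    ∃ E : ℝ, ∀ u, hamiltonian V (setHeight x k u)
      = E + (V (u - x.1 (siteL k)) + V (x.1 (siteR k) - u)) := by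
  let eL : Fin N := ⟨k.1, by omega⟩
  let eR : Fin N := ⟨k.1 + 1, by omega⟩
  have hne : eR ≠ eL := by simp [eL, eR, Fin.ext_iff]
  refine ⟨∑ i ∈ (Finset.univ.erase eL).erase eR, V (x.1 i.succ - x.1 i.castSucc), fun u => ?_⟩
  rw [hamiltonian, ← Finset.add_sum_erase _ _ (Finset.mem_univ eL),
    ← Finset.add_sum_erase _ _ (Finset.mem_erase.2 ⟨hne, Finset.mem_univ eR⟩)]
  have h1 : eL.succ = site k := rfl
  have h2 : eL.castSucc = siteL k := rfl
  have h3 : eR.succ = siteR k := rfl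
  have h4 : eR.castSucc = site k := rfl
  rw [h1, h2, h3, h4, setHeight_siteL, setHeight_siteR, setHeight_apply, if_pos rfl]
  have h5 : ∀ i ∈ (Finset.univ.erase eL).erase eR,
      V ((setHeight x k u).1 i.succ - (setHeight x k u).1 i.castSucc)
        = V (x.1 i.succ - x.1 i.castSucc) := fun i hi => by
    simp only [Finset.mem_erase, Finset.mem_univ, and_true] at hi
    rw [setHeight_apply, setHeight_apply, if_neg, if_neg]
    · intro h
      exact hi.1 (Fin.ext (by simpa [site] using congrArg Fin.val h))
    · intro h
      exact hi.2 (Fin.ext (by simpa [site] using congrArg Fin.val h))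
  rw [Finset.sum_congr rfl h5]
  ring

/-! ### Integrability of the Gibbs weight -/

theorem sum_gradient (x : Omega N) : ∑ i : Fin N, (x.1 i.succ - x.1 i.castSucc) = 0 := by
  have h1 := Fin.sum_univ_succ x.1
  have h2 := Fin.sum_univ_castSucc x.1
  rw [coord_zero] at h1
  rw [coord_last] at h2
  rw [Finset.sum_sub_distrib]
  linarith

theorem abs_coord_le (x : Omega N) (a : Fin (N + 1)) :
    |x.1 a| ≤ ∑ i : Fin N, |x.1 i.succ - x.1 i.castSucc| := by
  have key : ∀ a : Fin (N + 1), |x.1 a| ≤ ∑ i : Fin N with i.castSucc < a,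
      |x.1 i.succ - x.1 i.castSucc| := by
    intro a
    induction a using Fin.induction with
    | zero => simp [coord_zero]
    | succ i ih =>
      have hs : (Finset.univ.filter fun j : Fin N => j.castSucc < i.succ)
          = insert i (Finset.univ.filter fun j : Fin N => j.castSucc < i.castSucc) := by
        ext j
        simp only [Finset.mem_filter, Finset.mem_univ, true_and, Finset.mem_insert, Fin.lt_def,
          Fin.val_castSucc, Fin.val_succ, Fin.ext_iff]
        omega
      rw [hs, Finset.sum_insert (by simp)]
      have := abs_add_le (x.1 i.succ - x.1 i.castSucc) (x.1 i.castSucc)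
      rw [sub_add_cancel] at this
      linarith
  exact (key a).trans (Finset.sum_le_sum_of_subset_of_nonneg (Finset.filter_subset _ _)
    fun i _ _ => abs_nonneg _)

/-- The linear part of V sums to zero along a pinned path, leaving δ times the total variation of
the path, which dominates each height. -/
theorem Admissible.exists_le_hamiltonian (hV : Admissible V) (N : ℕ) :
    ∃ d C : ℝ, 0 < d ∧ ∀ y : Fin (N - 1) → ℝ,
      d * ∑ k, |y k| - C ≤ hamiltonian V (ofInterior y) := by
  obtain ⟨m, δ, C, hδ, h⟩ := hV.exists_linear_growth
  refine ⟨δ / (N + 1), N * C, by positivity, fun y => ?_⟩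
  set x := ofInterior y with hx
  have h1 : ∑ i : Fin N, (m * (x.1 i.succ - x.1 i.castSucc)
      + δ * |x.1 i.succ - x.1 i.castSucc| - C) ≤ hamiltonian V x :=
    Finset.sum_le_sum fun i _ => h _
  rw [Finset.sum_sub_distrib, Finset.sum_add_distrib, ← Finset.mul_sum, ← Finset.mul_sum,
    sum_gradient] at h1
  set S := ∑ i : Fin N, |x.1 i.succ - x.1 i.castSucc| with hS
  have hS0 : 0 ≤ S := Finset.sum_nonneg fun i _ => abs_nonneg _
  have h2 : ∑ k, |y k| ≤ (N + 1) * S := by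
    calc ∑ k, |y k| ≤ ∑ _k : Fin (N - 1), S := Finset.sum_le_sum fun k _ => by
          rw [← ofInterior_site y k]
          exact abs_coord_le x _
      _ = ((N - 1 : ℕ) : ℝ) * S := by simp
      _ ≤ (N + 1) * S := by
          refine mul_le_mul_of_nonneg_right ?_ hS0
          exact_mod_cast (by omega : N - 1 ≤ N + 1)
  have h3 : δ / (N + 1) * ∑ k, |y k| ≤ δ * S := by
    rw [div_mul_eq_mul_div, div_le_iff₀ (by positivity)]
    nlinarith
  simp at h1
  linarith

theorem integrable_exp_neg_sum_abs {d : ℝ} (hd : 0 < d) {ι : Type*} [Fintype ι] :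
    Integrable fun y : ι → ℝ => Real.exp (-(d * ∑ k, |y k|)) := by
  have h := Integrable.fintype_prod (ι := ι) (f := fun _ w => Real.exp (-(d * |w|)))
    (μ := fun _ => volume) fun _ => integrable_exp_neg_mul_abs hd
  refine h.congr (Eventually.of_forall fun y => ?_)
  simp only
  rw [← Real.exp_sum, Finset.mul_sum, Finset.sum_neg_distrib]

theorem Admissible.measurable_boltzmann (hV : Admissible V) :
    Measurable fun y : Fin (N - 1) → ℝ => Real.exp (-hamiltonian V (ofInterior y)) :=
  (hV.measurable_hamiltonian.comp measurable_ofInterior).neg.exp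

theorem Admissible.integrable_boltzmann (hV : Admissible V) :
    Integrable fun y : Fin (N - 1) → ℝ => Real.exp (-hamiltonian V (ofInterior y)) := by
  obtain ⟨d, C, hd, h⟩ := hV.exists_le_hamiltonian N
  refine ((integrable_exp_neg_sum_abs hd).const_mul (Real.exp C)).mono'
    hV.measurable_boltzmann.aestronglyMeasurable (Eventually.of_forall fun y => ?_)
  rw [Real.norm_of_nonneg (Real.exp_pos _).le, ← Real.exp_add, Real.exp_le_exp]
  linarith [h y]

theorem Admissible.integrable_sq_boltzmann (hV : Admissible V) (j : Fin (N - 1)) :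
    Integrable fun y : Fin (N - 1) → ℝ =>
      y j ^ 2 * Real.exp (-hamiltonian V (ofInterior y)) := by
  obtain ⟨d, C, hd, h⟩ := hV.exists_le_hamiltonian N
  refine ((integrable_exp_neg_sum_abs (half_pos hd)).const_mul (8 / d ^ 2 * Real.exp C)).mono'
    (((measurable_pi_apply j).pow_const 2).mul hV.measurable_boltzmann).aestronglyMeasurable
    (Eventually.of_forall fun y => ?_)
  have h1 := sq_le_exp (abs_nonneg (y j)) hd
  rw [sq_abs] at h1
  have h2 : |y j| ≤ ∑ k, |y k| :=
    Finset.single_le_sum (f := fun k => |y k|) (fun k _ => abs_nonneg _) (Finset.mem_univ j)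
  rw [Real.norm_of_nonneg (by positivity)]
  calc y j ^ 2 * Real.exp (-hamiltonian V (ofInterior y))
      ≤ 8 / d ^ 2 * Real.exp (d * (∑ k, |y k|) / 2) * Real.exp (-(d * ∑ k, |y k| - C)) := by
        refine mul_le_mul (h1.trans ?_) (Real.exp_le_exp.2 (neg_le_neg (h y)))
          (Real.exp_pos _).le (by positivity)
        gcongr
    _ = _ := by
        rw [mul_assoc, mul_assoc, ← Real.exp_add, ← Real.exp_add]
        ring_nf

/-- The partition function. -/
noncomputable def partition (V : ℝ → ℝ) (N : ℕ) : ℝ :=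
  ∫ z : Fin (N - 1) → ℝ, Real.exp (-hamiltonian V (ofInterior z))

theorem Admissible.partition_pos (hV : Admissible V) : 0 < partition V N :=
  integral_exp_pos hV.integrable_boltzmann

theorem Admissible.measurable_density (hV : Admissible V) :
    Measurable fun y : Fin (N - 1) → ℝ =>
      ENNReal.ofReal (Real.exp (-hamiltonian V (ofInterior y)) / partition V N) :=
  (hV.measurable_boltzmann.div_const _).ennreal_ofReal

theorem Admissible.isProbabilityMeasure_equilibrium (hV : Admissible V) :
    IsProbabilityMeasure (equilibrium V N) := by
  refine @Measure.isProbabilityMeasure_map _ _ _ _ _ ⟨?_⟩ _ measurable_ofInterior.aemeasurable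
  rw [withDensity_apply _ MeasurableSet.univ, Measure.restrict_univ]
  change ∫⁻ y : Fin (N - 1) → ℝ,
    ENNReal.ofReal (Real.exp (-hamiltonian V (ofInterior y)) / partition V N) = 1
  rw [← ofReal_integral_eq_lintegral_ofReal (hV.integrable_boltzmann.div_const _)
      (Eventually.of_forall fun y => div_nonneg (Real.exp_pos _).le hV.partition_pos.le),
    integral_div, ← partition, div_self hV.partition_pos.ne', ENNReal.ofReal_one]

theorem Admissible.lintegral_equilibrium (hV : Admissible V) {φ : Omega N → ENNReal}
    (hφ : Measurable φ) :
    ∫⁻ x, φ x ∂equilibrium V N = ∫⁻ y : Fin (N - 1) → ℝ,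
      ENNReal.ofReal (Real.exp (-hamiltonian V (ofInterior y)) / partition V N)
        * φ (ofInterior y) := by
  rw [equilibrium, lintegral_map hφ measurable_ofInterior]
  exact lintegral_withDensity_eq_lintegral_mul _ hV.measurable_density
    (hφ.comp measurable_ofInterior)

theorem Admissible.sqIntegrable_equilibrium (hV : Admissible V) :
    SqIntegrable (equilibrium V N) := by
  intro a
  rcases eq_zero_or_eq_last_or_eq_site a with rfl | rfl | ⟨i, rfl⟩
  · simp [coord_zero]
  · simp [coord_last]
  rw [equilibrium, integrable_map_measure
    ((measurable_coord _).pow_const 2).aestronglyMeasurable measurable_ofInterior.aemeasurable]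
  refine (integrable_withDensity_iff_integrable_smul' hV.measurable_density (by simp)).2 ?_
  refine ((hV.integrable_sq_boltzmann i).div_const (partition V N)).congr
    (Eventually.of_forall fun y => ?_)
  simp only [Function.comp_apply, smul_eq_mul, ofInterior_site]
  rw [ENNReal.toReal_ofReal (div_nonneg (Real.exp_pos _).le hV.partition_pos.le)]
  ring

/-! ### Invariance of equilibrium under heat-bath updates -/

theorem Admissible.lintegral_heatBath (hV : Admissible V) (k : Fin (N - 1)) (x : Omega N)
    {φ : Omega N → ENNReal} (hφ : Measurable φ) :
    ∫⁻ z, φ z ∂heatBath V k x = ∫⁻ u,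
      ENNReal.ofReal (rho V (x.1 (siteL k)) (x.1 (siteR k)) u) * φ (setHeight x k u) := by
  rw [hV.heatBath_apply, lintegral_map hφ (measurable_setHeight x k), hV.rhoKernel_apply]
  exact lintegral_withDensity_eq_lintegral_mul _ (hV.measurable_rho_right _ _)
    (hφ.comp (measurable_setHeight x k))

theorem Admissible.lintegral_heatBath_setHeight (hV : Admissible V) (k : Fin (N - 1)) (x : Omega N)
    (u : ℝ) {φ : Omega N → ENNReal} (hφ : Measurable φ) :
    ∫⁻ z, φ z ∂heatBath V k (setHeight x k u) = ∫⁻ z, φ z ∂heatBath V k x := by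
  rw [hV.lintegral_heatBath k _ hφ, hV.lintegral_heatBath k _ hφ]
  simp only [setHeight_siteL, setHeight_siteR, setHeight_setHeight]

/-- The equilibrium measure is invariant under each heat-bath update. -/
theorem Admissible.equilibrium_bind_heatBath (hV : Admissible V) (k : Fin (N - 1)) :
    (equilibrium V N).bind (heatBath V k) = equilibrium V N := by
  have := hV.isMarkovKernel_heatBath k
  refine Measure.ext_of_lintegral _ fun φ hφ => ?_
  have hψ : Measurable fun x => ∫⁻ z, φ z ∂heatBath V k x := hφ.lintegral_kernel
  rw [Measure.lintegral_bind (Kernel.aemeasurable _) hφ.aemeasurable,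
    hV.lintegral_equilibrium hψ, hV.lintegral_equilibrium hφ]
  -- It suffices to integrate over the height at site k alone: given the others, the Gibbs density
  -- is a constant times ρ_{b,c}, and the updated test function no longer depends on that height.
  refine lintegral_eq_of_lmarginal_eq {k} (hV.measurable_density.mul
    (hψ.comp measurable_ofInterior)) (hV.measurable_density.mul
    (hφ.comp measurable_ofInterior)) ?_
  rw [lmarginal_singleton, lmarginal_singleton]
  funext y
  simp only [← setHeight_ofInterior,
    hV.lintegral_heatBath_setHeight k _ _ hφ]
  set x := ofInterior y
  obtain ⟨E, hE⟩ := exists_hamiltonian_setHeight V x k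
  set b := x.1 (siteL k)
  set c := x.1 (siteR k)
  set Z := ∫ s, Real.exp (-V (s - b) - V (c - s)) with hZ
  have hZ0 : 0 < Z := hV.integral_weight_pos b c
  have hfac : ∀ u, ENNReal.ofReal (Real.exp (-hamiltonian V (setHeight x k u)) / partition V N)
      = ENNReal.ofReal (Real.exp (-E) * Z / partition V N) * ENNReal.ofReal (rho V b c u) := by
    intro u
    have hp := hV.partition_pos (N := N)
    rw [← ENNReal.ofReal_mul (by positivity), hE, rho, ← hZ]
    congr 1
    rw [neg_add, Real.exp_add, neg_add']
    field_simp
  have hρ := hV.measurable_rho_right b c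
  have h1 : ∫⁻ u, ENNReal.ofReal (rho V b c u) = 1 := by
    have := hV.isMarkovKernel_rhoKernel.isProbabilityMeasure (b, c)
    have h := this.measure_univ
    rwa [hV.rhoKernel_apply, withDensity_apply _ MeasurableSet.univ, Measure.restrict_univ] at h
  simp only [hfac]
  rw [lintegral_mul_const _ (hρ.const_mul _), lintegral_const_mul _ hρ, h1, mul_one,
    hV.lintegral_heatBath k x hφ]
  simp only [mul_assoc]
  exact (lintegral_const_mul _ (hρ.mul (hφ.comp (measurable_setHeight x k)))).symm

/-! ### Moments at equilibrium -/

/-- A matrix which is subharmonic off the diagonal and, up to a source `C` on the diagonal,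
subharmonic for the two-particle walk is dominated by the bridge covariance. -/
theorem le_bridge_of_subharmonic {G : Fin (N + 1) → Fin (N + 1) → ℝ} {C : ℝ} (hC : 0 ≤ C)
    (hbd : ∀ a b, (a = 0 ∨ a = Fin.last N ∨ b = 0 ∨ b = Fin.last N) → G a b = 0)
    (hoff : ∀ i j : Fin (N - 1), i ≠ j →
      G (site i) (site j) ≤ (G (siteL i) (site j) + G (siteR i) (site j)) / 2)
    (hdiag : ∀ i : Fin (N - 1), G (site i) (site i) ≤ 7 / 16 * G (siteL i) (siteL i)
      + 7 / 16 * G (siteR i) (siteR i) + 1 / 8 * G (siteL i) (siteR i) + C)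
    (a b : Fin (N + 1)) : G a b ≤ 8 * C * bridge N a b := by
  -- Subtracting ε(p a + p b), with p strictly concave, makes the comparison strict. The weights
  -- total 1, so at an interior maximum F would be at most its maximum minus ε off the diagonal, or
  -- minus 2ε on it.
  let p : Fin (N + 1) → ℝ := fun a => a.1 * (N - a.1)
  have hp0 : ∀ a, 0 ≤ p a := fun a => mul_nonneg (by positivity)
    (sub_nonneg.2 (by exact_mod_cast a.is_le))
  have hp : ∀ k : Fin (N - 1), p (siteL k) + p (siteR k) = 2 * p (site k) - 2 := fun k => by
    simp only [p, siteL, siteR, site]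
    push_cast
    ring
  have key : ∀ ε : ℝ, 0 < ε → ∀ a b, G a b - 8 * C * bridge N a b - ε * (p a + p b) ≤ 0 := by
    intro ε hε
    let F : Fin (N + 1) × Fin (N + 1) → ℝ :=
      fun q => G q.1 q.2 - 8 * C * bridge N q.1 q.2 - ε * (p q.1 + p q.2)
    obtain ⟨⟨a₀, b₀⟩, h₀⟩ := Finite.exists_max F
    have hmax : ∀ a b, F (a, b) ≤ F (a₀, b₀) := fun a b => h₀ (a, b)
    suffices h : F (a₀, b₀) ≤ 0 from fun a b => (hmax a b).trans h
    have hb : (a₀ = 0 ∨ a₀ = Fin.last N ∨ b₀ = 0 ∨ b₀ = Fin.last N) → F (a₀, b₀) ≤ 0 := fun h => by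
      have h1 := mul_nonneg (mul_nonneg (by norm_num : (0 : ℝ) ≤ 8) hC) (bridge_nonneg a₀ b₀)
      have h2 := mul_nonneg hε.le (add_nonneg (hp0 a₀) (hp0 b₀))
      simp only [F, hbd _ _ h]
      linarith
    rcases eq_zero_or_eq_last_or_eq_site a₀ with ha | ha | ⟨i, rfl⟩
    · exact hb (Or.inl ha)
    · exact hb (Or.inr (Or.inl ha))
    rcases eq_zero_or_eq_last_or_eq_site b₀ with hb' | hb' | ⟨j, rfl⟩
    · exact hb (Or.inr (Or.inr (Or.inl hb')))
    · exact hb (Or.inr (Or.inr (Or.inr hb')))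
    exfalso
    by_cases hij : i = j
    · subst hij
      have h1 := hmax (siteL i) (siteL i)
      have h2 := hmax (siteR i) (siteR i)
      have h3 := hmax (siteL i) (siteR i)
      have h4 := hdiag i
      have h5 := mul_le_mul_of_nonneg_left (bridge_diag i) (mul_nonneg (by norm_num : (0 : ℝ) ≤ 8) hC)
      have h6 := congrArg (ε * ·) (hp i)
      simp only [F] at h1 h2 h3 h6
      linarith
    · have h1 := hmax (siteL i) (site j)
      have h2 := hmax (siteR i) (site j)
      have h4 := hoff i j hij
      have h5 := congrArg (8 * C * ·)
        (bridge_harmonic fun h : site j = site i => hij (site_injective h).symm)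
      have h6 := congrArg (ε * ·) (hp i)
      simp only [F] at h1 h2 h5 h6
      linarith
  by_contra! h
  set Δ := G a b - 8 * C * bridge N a b with hΔ
  have hΔ0 : 0 < Δ := sub_pos.2 h
  have hq : 0 < p a + p b + 1 := by linarith [hp0 a, hp0 b]
  have h1 := key (Δ / (p a + p b + 1)) (div_pos hΔ0 hq) a b
  rw [← hΔ, sub_nonpos, div_mul_eq_mul_div, le_div_iff₀ hq] at h1
  linarith

theorem Admissible.integral_equilibrium_eq (hV : Admissible V) (k : Fin (N - 1)) {φ : Omega N → ℝ}
    (h : Integrable φ (equilibrium V N)) :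
    ∫ x, φ x ∂equilibrium V N = ∫ x, ∫ z, φ z ∂heatBath V k x ∂equilibrium V N := by
  rw [← integral_bind_kernel (by rwa [hV.equilibrium_bind_heatBath]), hV.equilibrium_bind_heatBath]

theorem Admissible.secondMoment_equilibrium_le (hV : Admissible V) {C : ℝ} (hC : VarBound V C)
    (a b : Fin (N + 1)) : secondMoment (equilibrium V N) a b ≤ 8 * C * bridge N a b := by
  have := hV.isProbabilityMeasure_equilibrium (N := N)
  have hS := hV.sqIntegrable_equilibrium (N := N)
  refine le_bridge_of_subharmonic hC.1 (fun a b h => secondMoment_of_boundary _ h) ?_ ?_ a b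
  · intro i j hij
    rw [secondMoment, hV.integral_equilibrium_eq i (hS.mul _ _)]
    simp only [hV.integral_mul_heatBath i _ (fun h => hij (site_injective h).symm :
      site j ≠ site i) rfl]
    exact (hS.integral_nbrMean_mul i (site j)).le
  · intro i
    simp only [secondMoment, ← pow_two]
    rw [hV.integral_equilibrium_eq i (hS _)]
    calc ∫ x, ∫ z, z.1 (site i) ^ 2 ∂heatBath V i x ∂equilibrium V N
        ≤ ∫ x, (nbrForm x i + C) ∂equilibrium V N := by
          refine integral_mono_of_nonneg
            (Eventually.of_forall fun y => integral_nonneg fun z => sq_nonneg _)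
            ((hS.nbrForm i).add (integrable_const C)) (Eventually.of_forall fun y => ?_)
          have := hV.integral_sq_heatBath_le hC i y i
          rw [if_pos rfl] at this
          simpa using this
      _ = _ := by
          rw [integral_add (hS.nbrForm i) (integrable_const C), hS.integral_nbrForm,
            integral_const]
          simp

/-- By invariance the mean profile u is discrete harmonic with zero boundary values. The maximum
principle, applied to the matrix u_a u_b with source 0, gives u_a² ≤ 0. -/
theorem Admissible.integral_coord_equilibrium (hV : Admissible V) (a : Fin (N + 1)) :
    ∫ x, x.1 a ∂equilibrium V N = 0 := by
  have := hV.isProbabilityMeasure_equilibrium (N := N)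
  have hS := hV.sqIntegrable_equilibrium (N := N)
  let u : Fin (N + 1) → ℝ := fun a => ∫ x, x.1 a ∂equilibrium V N
  have hu : ∀ i, u (site i) = (u (siteL i) + u (siteR i)) / 2 := fun i => by
    simp only [u]
    rw [hV.integral_equilibrium_eq i (hS.coord _)]
    simp only [hV.integral_coord_heatBath, if_true, add_sub_cancel]
    exact hS.integral_nbrMean i
  have h := le_bridge_of_subharmonic (G := fun a b => u a * u b) le_rfl
    (fun a b h => by rcases h with rfl | rfl | rfl | rfl <;> simp [u, coord_zero, coord_last])
    (fun i j _ => by simp only [hu i]; linarith)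
    (fun i => by
      simp only [hu i]
      nlinarith [sq_nonneg (u (siteL i) - u (siteR i))]) a a
  simp only [mul_zero, zero_mul] at h
  exact mul_self_eq_zero.1 (le_antisymm h (mul_self_nonneg _))

/-! ### The first eigenfunction and the lower bound -/

/-- The profile `N sin (π a / N)`. -/
noncomputable def sineProfile (hN : N ≠ 0) : Omega N :=
  ⟨fun a => N * Real.sin (Real.pi * a.1 / N), by simp, by
    have : (N : ℝ) ≠ 0 := by exact_mod_cast hN
    simp [this]⟩

theorem sineProfile_apply (hN : N ≠ 0) (a : Fin (N + 1)) :
    (sineProfile hN).1 a = N * Real.sin (Real.pi * a.1 / N) := rfl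

theorem abs_sineProfile_le (hN : N ≠ 0) (a : Fin (N + 1)) : |(sineProfile hN).1 a| ≤ N := by
  rw [sineProfile_apply, abs_mul, Nat.abs_cast]
  exact mul_le_of_le_one_right (by positivity) (Real.abs_sin_le_one _)

theorem sineProfile_nonneg (hN : N ≠ 0) (a : Fin (N + 1)) : 0 ≤ (sineProfile hN).1 a := by
  have hN' : (0 : ℝ) < N := by exact_mod_cast Nat.pos_of_ne_zero hN
  have ha : (a.1 : ℝ) ≤ N := by exact_mod_cast a.is_le
  refine mul_nonneg hN'.le (Real.sin_nonneg_of_nonneg_of_le_pi (by positivity) ?_)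
  rw [div_le_iff₀ hN']
  exact mul_le_mul_of_nonneg_left ha Real.pi_pos.le

theorem sineProfile_neighbours (hN : N ≠ 0) (k : Fin (N - 1)) :
    (sineProfile hN).1 (siteL k)
        = N * Real.sin (Real.pi * (k.1 + 1) / N - Real.pi / N) ∧
      (sineProfile hN).1 (siteR k) = N * Real.sin (Real.pi * (k.1 + 1) / N + Real.pi / N) := by
  constructor <;>
  · rw [sineProfile_apply]
    simp only [siteL, siteR]
    push_cast
    congr 2
    ring

theorem nbrMean_sineProfile (hN : N ≠ 0) (k : Fin (N - 1)) :
    nbrMean (sineProfile hN) k = (1 - rate N) * (sineProfile hN).1 (site k) := by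
  obtain ⟨h1, h2⟩ := sineProfile_neighbours hN k
  rw [nbrMean, h1, h2, Real.sin_sub, Real.sin_add, sineProfile_apply, rate]
  simp only [site]
  push_cast
  ring

/-- The amplitude N makes each increment at most π in absolute value, and the rate times the height
is minus half the second difference. -/
theorem sineProfile_slope_le (hN : N ≠ 0) (k : Fin (N - 1)) :
    (rate N * (sineProfile hN).1 (site k)) ^ 2
      + 3 / 16 * ((sineProfile hN).1 (siteR k) - (sineProfile hN).1 (siteL k)) ^ 2
      ≤ 2 * Real.pi ^ 2 := by
  obtain ⟨h1, h2⟩ := sineProfile_neighbours hN k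
  have hN' : (0 : ℝ) < N := by exact_mod_cast Nat.pos_of_ne_zero hN
  have h3 : (sineProfile hN).1 (site k) = N * Real.sin (Real.pi * (k.1 + 1) / N) := by
    rw [sineProfile_apply]
    simp only [site]
    push_cast
    rfl
  have lip : ∀ x y : ℝ, |Real.sin x - Real.sin y| ≤ |x - y| := fun x y => by
    have := Real.lipschitzWith_sin.dist_le_mul x y
    simpa [Real.dist_eq] using this
  set θ := Real.pi * (k.1 + 1) / N
  have hd : ∀ x y : ℝ, |N * Real.sin x - N * Real.sin y| ≤ N * |x - y| := fun x y => by
    rw [← mul_sub, abs_mul, Nat.abs_cast]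
    exact mul_le_mul_of_nonneg_left (lip x y) hN'.le
  have e : (N : ℝ) * |Real.pi / N| = Real.pi := by
    rw [abs_of_pos (div_pos Real.pi_pos hN')]
    field_simp
  have hm := nbrMean_sineProfile hN k
  rw [nbrMean, h1, h2, h3] at hm
  rw [h1, h2, h3]
  have d1 := hd θ (θ - Real.pi / N)
  have d2 := hd (θ + Real.pi / N) θ
  rw [sub_sub_cancel, e] at d1
  rw [add_sub_cancel_left, e] at d2
  set A := N * Real.sin (θ - Real.pi / N)
  set B := N * Real.sin θ
  set D := N * Real.sin (θ + Real.pi / N)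
  have hr : rate N * B = ((B - A) - (D - B)) / 2 := by linarith
  rw [hr]
  have q1 : (B - A) ^ 2 ≤ Real.pi ^ 2 := sq_le_sq.2 (by rwa [abs_of_pos Real.pi_pos])
  have q2 : (D - B) ^ 2 ≤ Real.pi ^ 2 := sq_le_sq.2 (by rwa [abs_of_pos Real.pi_pos])
  nlinarith [sq_nonneg ((B - A) - (D - B)), sq_nonneg ((B - A) + (D - B))]

theorem rate_nonneg (N : ℕ) : 0 ≤ rate N := sub_nonneg.2 (Real.cos_le_one _)

theorem rate_le_one (hN : 2 ≤ N) : rate N ≤ 1 := by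
  have hN' : (2 : ℝ) ≤ N := by exact_mod_cast hN
  have : 0 ≤ Real.cos (Real.pi / N) := by
    refine Real.cos_nonneg_of_mem_Icc ⟨?_, ?_⟩
    · have : 0 ≤ Real.pi / N := by positivity
      linarith [Real.pi_pos]
    · exact div_le_div_of_nonneg_left Real.pi_pos.le (by norm_num) hN'
  rw [rate]
  linarith

theorem rate_pos (hN : 2 ≤ N) : 0 < rate N := by
  have hN' : (2 : ℝ) ≤ N := by exact_mod_cast hN
  have h := Real.cos_lt_cos_of_nonneg_of_le_pi le_rfl
    (div_le_self Real.pi_pos.le (by linarith : (1 : ℝ) ≤ N)) (by positivity : 0 < Real.pi / N)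
  rw [Real.cos_zero] at h
  rw [rate]
  linarith

theorem sum_sin_sq (hN : 2 ≤ N) :
    ∑ a : Fin (N + 1), Real.sin (Real.pi * a.1 / N) ^ 2 = N / 2 := by
  have hN' : (2 : ℝ) ≤ N := by exact_mod_cast hN
  set θ := Real.pi / N with hθ
  have hNθ : N * θ = Real.pi := by rw [hθ]; field_simp
  have hs : 0 < Real.sin θ := Real.sin_pos_of_pos_of_lt_pi (by positivity)
    (div_lt_self Real.pi_pos (by linarith))
  -- Telescoping: 2 sin θ cos(2aθ) = sin((2a+1)θ) - sin((2a-1)θ).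
  have tele : ∀ n : ℕ, 2 * Real.sin θ * ∑ a ∈ Finset.range n, Real.cos (2 * (a * θ))
      = Real.sin ((2 * n - 1) * θ) + Real.sin θ := by
    intro n
    induction n with
    | zero => simp
    | succ n ih =>
      rw [Finset.sum_range_succ, mul_add, ih]
      have e1 : (2 * ((n + 1 : ℕ) : ℝ) - 1) * θ = 2 * (n * θ) + θ := by push_cast; ring
      have e2 : (2 * (n : ℝ) - 1) * θ = 2 * (n * θ) - θ := by ring
      rw [e1, e2, Real.sin_add, Real.sin_sub]
      ring
  have h0 : ∑ a ∈ Finset.range N, Real.cos (2 * (a * θ)) = 0 := by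
    have h := tele N
    have e : (2 * (N : ℝ) - 1) * θ = 2 * Real.pi - θ := by rw [← hNθ]; ring
    rw [e, Real.sin_two_pi_sub, neg_add_cancel] at h
    exact (mul_eq_zero.1 h).resolve_left (by positivity)
  rw [Fin.sum_univ_eq_sum_range (fun a => Real.sin (Real.pi * a / N) ^ 2) (N + 1),
    Finset.sum_range_succ]
  have e : ∀ a : ℕ, Real.sin (Real.pi * a / N) ^ 2 = 1 / 2 - Real.cos (2 * (a * θ)) / 2 := by
    intro a
    rw [Real.sin_sq_eq_half_sub, hθ]
    ring_nf
  have e' : Real.sin (Real.pi * N / N) = 0 := by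
    rw [mul_div_assoc, div_self (by positivity), mul_one, Real.sin_pi]
  simp only [e', e, Finset.sum_sub_distrib]
  rw [← Finset.sum_div, ← Finset.sum_div, h0]
  simp

/-- The linear statistic associated with the first eigenfunction of the discrete Laplacian. -/
noncomputable def sineStat (x : Omega N) : ℝ :=
  ∑ a : Fin (N + 1), Real.sin (Real.pi * a.1 / N) * x.1 a

theorem sin_nonneg_site (hN : N ≠ 0) (a : Fin (N + 1)) : 0 ≤ Real.sin (Real.pi * a.1 / N) := by
  have hN' : (0 : ℝ) < N := by exact_mod_cast Nat.pos_of_ne_zero hN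
  exact nonneg_of_mul_nonneg_right (sineProfile_nonneg hN a) hN'

theorem sineStat_sineProfile (hN : 2 ≤ N) :
    sineStat (sineProfile (by omega : N ≠ 0)) = (N : ℝ) ^ 2 / 2 := by
  have e : ∀ a : Fin (N + 1), Real.sin (Real.pi * a.1 / N)
      * (sineProfile (by omega : N ≠ 0)).1 a = N * Real.sin (Real.pi * a.1 / N) ^ 2 :=
    fun a => by rw [sineProfile_apply]; ring
  rw [sineStat]
  simp only [e]
  rw [← Finset.mul_sum, sum_sin_sq hN]
  ring

section Stat

variable {μ : Measure (Omega N)}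

theorem sineStat_sq (x : Omega N) : sineStat x ^ 2 = ∑ a : Fin (N + 1), ∑ b : Fin (N + 1),
    Real.sin (Real.pi * a.1 / N) * Real.sin (Real.pi * b.1 / N) * (x.1 a * x.1 b) := by
  rw [sineStat, pow_two, Finset.sum_mul_sum]
  refine Finset.sum_congr rfl fun a _ => Finset.sum_congr rfl fun b _ => by ring

theorem SqIntegrable.sineStat [IsFiniteMeasure μ] (h : SqIntegrable μ) :
    Integrable (fun x : Omega N => sineStat x) μ :=
  integrable_finsetSum _ fun a _ => (h.coord a).const_mul _

theorem SqIntegrable.integral_sineStat [IsFiniteMeasure μ] (h : SqIntegrable μ) :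
    ∫ x, GradPhi.sineStat x ∂μ
      = ∑ a : Fin (N + 1), Real.sin (Real.pi * a.1 / N) * ∫ x, x.1 a ∂μ := by
  simp only [GradPhi.sineStat]
  rw [integral_finsetSum _ fun a _ => (h.coord a).const_mul _]
  simp only [integral_const_mul]

theorem SqIntegrable.sineStat_sq (h : SqIntegrable μ) :
    Integrable (fun x : Omega N => GradPhi.sineStat x ^ 2) μ := by
  simp only [GradPhi.sineStat_sq]
  exact integrable_finsetSum _ fun a _ => integrable_finsetSum _ fun b _ =>
    (h.mul a b).const_mul _

/-- Entrywise upper bounds on second moments can be summed because the sine weights are nonnegative.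
The (N+1)² ≤ 4N² pairs contribute at most K N each. -/
theorem SqIntegrable.integral_sineStat_sq_le (h : SqIntegrable μ) (hN : 1 ≤ N) {r K : ℝ}
    (hK : 0 ≤ K) {x : Omega N}
    (hb : ∀ a b, secondMoment μ a b ≤ r * (x.1 a * x.1 b) + K * bridge N a b) :
    ∫ z, GradPhi.sineStat z ^ 2 ∂μ ≤ r * GradPhi.sineStat x ^ 2 + 4 * K * N ^ 3 := by
  have hN0 : N ≠ 0 := by omega
  have hN' : (1 : ℝ) ≤ N := by exact_mod_cast hN
  simp only [GradPhi.sineStat_sq]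
  rw [integral_finsetSum _ fun a _ => integrable_finsetSum _ fun b _ => (h.mul a b).const_mul _]
  calc ∑ a : Fin (N + 1), ∫ z : Omega N, ∑ b : Fin (N + 1), Real.sin (Real.pi * a.1 / N)
        * Real.sin (Real.pi * b.1 / N) * (z.1 a * z.1 b) ∂μ
      = ∑ a : Fin (N + 1), ∑ b : Fin (N + 1), Real.sin (Real.pi * a.1 / N)
        * Real.sin (Real.pi * b.1 / N) * secondMoment μ a b := by
        refine Finset.sum_congr rfl fun a _ => ?_
        rw [integral_finsetSum _ fun b _ => (h.mul a b).const_mul _]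
        simp only [integral_const_mul, secondMoment]
    _ ≤ ∑ a : Fin (N + 1), ∑ b : Fin (N + 1), (r * (Real.sin (Real.pi * a.1 / N)
        * Real.sin (Real.pi * b.1 / N) * (x.1 a * x.1 b)) + K * N) := by
        refine Finset.sum_le_sum fun a _ => Finset.sum_le_sum fun b _ => ?_
        have s0 := mul_nonneg (sin_nonneg_site hN0 a) (sin_nonneg_site hN0 b)
        have s1 : Real.sin (Real.pi * a.1 / N) * Real.sin (Real.pi * b.1 / N) ≤ 1 :=
          mul_le_one₀ (Real.sin_le_one _) (sin_nonneg_site hN0 b) (Real.sin_le_one _)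
        have h1 := mul_le_mul_of_nonneg_left (hb a b) s0
        have h2 := mul_le_mul_of_nonneg_left (bridge_le a b) hK
        have h3 := mul_le_mul s1 h2 (mul_nonneg hK (bridge_nonneg a b)) zero_le_one
        linarith
    _ = r * (∑ a : Fin (N + 1), ∑ b : Fin (N + 1), Real.sin (Real.pi * a.1 / N)
        * Real.sin (Real.pi * b.1 / N) * (x.1 a * x.1 b)) + ((N : ℝ) + 1) ^ 2 * (K * N) := by
        simp only [Finset.sum_add_distrib, Finset.mul_sum]
        simp
        ring
    _ ≤ _ := by
        have h4 : ((N : ℝ) + 1) ^ 2 ≤ 4 * N ^ 2 := by nlinarith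
        have h5 := mul_le_mul_of_nonneg_right h4 (mul_nonneg hK (by positivity : (0 : ℝ) ≤ N))
        nlinarith

end Stat

/-! ### Assembling the lower bounds -/

theorem Admissible.tvDist_law_le_worstDist (hV : Admissible V) {x : Omega N}
    (hx : ∀ i, |x.1 i| ≤ (N : ℝ)) {t : ℝ} (ht : 0 ≤ t) :
    tvDist (law V x t) (equilibrium V N) ≤ worstDist V N t := by
  refine le_ciSup (f := fun x : {x : Omega N // ∀ i, |x.1 i| ≤ (N : ℝ)} =>
    tvDist (law V x.1 t) (equilibrium V N)) ⟨1, ?_⟩ ⟨x, hx⟩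
  rintro _ ⟨z, rfl⟩
  have := hV.isProbabilityMeasure_law z.1 ht
  exact tvDist_le_one

theorem Admissible.exists_le_worstDist (hV : Admissible V) :
    ∃ c : ℝ, 0 < c ∧ ∀ N : ℕ, 2 ≤ N → ∀ t : ℝ, 0 ≤ t →
      1 - 1 / (1 + c * N * Real.exp (-2 * rate N * t)) ≤ worstDist V N t := by
  obtain ⟨C, hC⟩ : ∃ C, VarBound V C := hV.exists_integral_sq_rhoKernel_le
  have hC0 := hC.1
  set K := 8 * (2 * Real.pi ^ 2 + C) with hK
  have hK0 : 0 < K := by positivity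
  -- The constant is read off from m²/(4S) with m = e^{-λ_N t} N²/2 and S = 4 K N³.
  refine ⟨1 / (64 * K), by positivity, fun N hN t ht => ?_⟩
  have hN0 : N ≠ 0 := by omega
  have hN' : (2 : ℝ) ≤ N := by exact_mod_cast hN
  set x := sineProfile hN0 with hx
  have hmean := nbrMean_sineProfile hN0
  have hslope := sineProfile_slope_le hN0
  have hD : 0 ≤ 2 * Real.pi ^ 2 := by positivity
  have pP := hV.isProbabilityMeasure_law x ht
  have pQ := hV.isProbabilityMeasure_equilibrium (N := N)
  have sP := hV.sqIntegrable_law hC (rate_nonneg N) (rate_le_one hN) hD hmean hslope ht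
  have sQ := hV.sqIntegrable_equilibrium (N := N)
  have eP : ∫ z, sineStat z ∂law V x t = Real.exp (-rate N * t) * (N ^ 2 / 2) := by
    rw [sP.integral_sineStat, ← sineStat_sineProfile hN, sineStat, Finset.mul_sum]
    refine Finset.sum_congr rfl fun a _ => ?_
    rw [hV.integral_coord_law hC (rate_nonneg N) (rate_le_one hN) hD hmean hslope ht]
    ring
  have eQ : ∫ z, sineStat z ∂equilibrium V N = 0 := by
    rw [sQ.integral_sineStat]
    simp [hV.integral_coord_equilibrium]
  have hexp : Real.exp (-rate N * t) ^ 2 = Real.exp (-2 * rate N * t) := by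
    rw [← Real.exp_nat_mul]
    push_cast
    ring_nf
  have bP := sP.integral_sineStat_sq_le (by omega : 1 ≤ N) hK0.le
    (hV.secondMoment_law_le hC (rate_nonneg N) (rate_le_one hN) hD hmean hslope ht)
  have bQ := sQ.integral_sineStat_sq_le (r := 0) (x := x) (by omega : 1 ≤ N) hK0.le
    fun a b => by
      refine (hV.secondMoment_equilibrium_le hC a b).trans ?_
      have := mul_nonneg hD (bridge_nonneg a b)
      rw [hK]
      linarith
  rw [sineStat_sineProfile hN, ← hexp] at bP
  rw [zero_mul, zero_add] at bQ
  have h := le_tvDist_of_moments sP.sineStat sP.sineStat_sq sQ.sineStat sQ.sineStat_sq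
    (m := Real.exp (-rate N * t) * (N ^ 2 / 2)) (S := 4 * K * N ^ 3) (by positivity)
    (by positivity) eP eQ (by rwa [mul_pow]) bQ
  refine le_trans (le_of_eq ?_)
    (h.trans (hV.tvDist_law_le_worstDist (abs_sineProfile_le hN0) ht))
  rw [mul_pow, hexp]
  congr 3
  field_simp
  norm_num

theorem Admissible.exists_le_mixingTime (hV : Admissible V) :
    ∃ C : ℝ, ∀ N : ℕ, 2 ≤ N → ∀ ε : ℝ, 0 < ε → ε < 1 →
      ((1 / (2 * rate N) * (Real.log N + Real.log (1 - ε) - C) : ℝ) : EReal) ≤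
        mixingTime V N ε := by
  obtain ⟨c, hc, h⟩ := hV.exists_le_worstDist
  -- Bounding each admissible t also covers the case where no t qualifies and the infimum is +∞.
  refine ⟨-Real.log c, fun N hN ε hε0 hε1 => le_iInf₂ fun t ht => ?_⟩
  have hN' : (0 : ℝ) < N := by exact_mod_cast (by omega : 0 < N)
  have hr := rate_pos hN
  have h1 := (h N hN t ht.1).trans_lt ht.2
  set q := c * N * Real.exp (-2 * rate N * t) with hq
  have hq0 : 0 < q := by positivity
  have h2 : (1 - ε) * q < 1 := by
    have h3 : 1 - ε < 1 / (1 + q) := by linarith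
    rw [lt_div_iff₀ (by positivity)] at h3
    nlinarith
  have h4 := Real.log_lt_log (mul_pos (sub_pos.2 hε1) hq0) h2
  rw [Real.log_one, Real.log_mul (sub_pos.2 hε1).ne' hq0.ne', hq,
    Real.log_mul (by positivity) (Real.exp_pos _).ne', Real.log_mul hc.ne' hN'.ne',
    Real.log_exp] at h4
  rw [EReal.coe_le_coe_iff, one_div, inv_mul_le_iff₀ (by positivity)]
  linarith

end GradPhi

theorem proposition3p1 (V : ℝ → ℝ) (hV : GradPhi.Admissible V) :
    (∃ c : ℝ, 0 < c ∧ ∀ N : ℕ, 2 ≤ N → ∀ t : ℝ, 0 ≤ t →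
      1 - 1 / (1 + c * N * Real.exp (-2 * GradPhi.rate N * t)) ≤ GradPhi.worstDist V N t) ∧
    (∃ C : ℝ, ∀ N : ℕ, 2 ≤ N → ∀ ε : ℝ, 0 < ε → ε < 1 →
      ((1 / (2 * GradPhi.rate N) * (Real.log N + Real.log (1 - ε) - C) : ℝ) : EReal) ≤
        GradPhi.mixingTime V N ε) :=
  ⟨hV.exists_le_worstDist, hV.exists_le_mixingTime⟩
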